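/- Setting. Let $\mathcal S,\mathcal A$ be measurable spaces, $P_S$ a probability distribution on $\mathcal S$, $P_R(\cdot\mid s,a)$ a Markov kernel from $\mathcal S\times\mathcal A$ to $\mathbb R$, and let $\pi_b,\pi_e$ be two policies given by conditional densities $\pi_b(a\mid s),\pi_e(a\mid s)$ with respect to a common ($s$-finite) reference measure on $\mathcal A$, possibly depending measurably on $s$. Put $w(s,a)=\pi_e(a\mid s)/\pi_b(a\mid s)$ (with $0/0=0$) and $B=\inf\{b:\pi_e(a\mid s)\le b\,\pi_b(a\mid s)\ \text{for all }(s,a)\}$, and assume $B<\infty$. Let $P^{\pi_e}$ be the law of $(S,R)$ when $S\sim P_S$, $A\sim\pi_e(\cdot\mid S)$, $R\sim P_R(\cdot\mid S,A)$. Let $\epsilon,\delta,\gamma\in(0,1)$ and $0\le\epsilon_{\mathrm{lo}}<\epsilon_{\mathrm{up}}\le 1$ with $\epsilon_{\mathrm{up}}-\epsilon_{\mathrm{lo}}=1-\epsilon$. Let $q_{\epsilon_{\mathrm{lo}}},q_{\epsilon_{\mathrm{up}}}:\mathcal S\to\mathbb R$ be (measurable) conditional quantile functions of $R$ given $S$ under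 $P^{\pi_e}$ of levels $\epsilon_{\mathrm{lo}}$ and $\epsilon_{\mathrm{up}}$, i.e. $\mathbb P(R<q_p(s)\mid S=s)\le p\le\mathbb P(R\le q_p(s)\mid S=s)$ for $P_S$-almost every $s$. Algorithm. Let $(S_i,A_i,R_i)$, $i\le n$, be i.i.d. with $S_i\sim P_S$, $A_i\sim\pi_b(\cdot\mid S_i)$, $R_i\sim P_R(\cdot\mid S_i,A_i)$, let $V_1,\dots,V_n$ be i.i.d. uniform on $[0,1]$ and independent of them, and let the test context $S_{n+1}\sim P_S$ be independent of all of these. (a) Keep the pairs $(S_i,R_i)$ with $V_i\le w(S_i,A_i)/B$; let $N$ be their number. (b) Split the kept pairs, by any rule that depends only on $N$ and possibly on a random seed independent of everything else, into a calibration set of size $M=\lceil\gamma N\rceil$ and a training set $\mathcal D_1$ of size $N-M$. (c) Apply to $\mathcal D_1$ a deterministic (measurable) quantile estimation procedure, which gives functions $\hat q_{\epsilon_{\mathrm{lo}}},\hat q_{\epsilon_{\mathrm{up}}}:\mathcal S\to\mathbb R$. (d) For each calibration pair compute the score $\tau_i=\max\{\hat q_{\epsilon_{\mathrm{lo}}}(S_i)-R_i,\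 R_i-\hat q_{\epsilon_{\mathrm{up}}}(S_i)\}$; let $\tau_{(1)}\le\dots\le\tau_{(M)}$ be the ordered scores and $\tau_{(M+1)}=\infty$. Let $k$ be the largest $k\in\{-1,0,\dots,M-1\}$ with $F_{\mathrm{Bin}(M,\epsilon)}(k)\le\delta$, where $F_{\mathrm{Bin}(M,\epsilon)}$ is the binomial distribution function, and put $\tilde\tau=\tau_{(M-k)}$. (e) Output $\hat C_{\tilde\tau}(S_{n+1})=[\hat q_{\epsilon_{\mathrm{lo}}}(S_{n+1})-\tilde\tau,\ \hat q_{\epsilon_{\mathrm{up}}}(S_{n+1})+\tilde\tau]$, which is $\mathbb R$ if $\tilde\tau=\infty$ and empty if the left endpoint exceeds the right one. Assumptions. (1) Consistency: there are sequences $\eta_l\to0$ and $\rho_l\to0$ such that for all sufficiently large $l$, if the procedure in (c) is applied to a training set $\mathcal D_1$ of $l$ i.i.d. draws from $P^{\pi_e}$ and $S\sim P_S$ is independent of $\mathcal D_1$, then $$\mathbb P\Big[\mathbb E\big[(\hat q_{p}(S)-q_{p}(S))^2\mid\mathcal D_1\big]\le\eta_l/2\Big]\ \ge\ 1-\rho_l/2\qquad\text{for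 }p=\epsilon_{\mathrm{lo}}\text{ and for }p=\epsilon_{\mathrm{up}}.$$ (2) Regularity: for $(S,R)\sim P^{\pi_e}$, the random variable $T=\max\{q_{\epsilon_{\mathrm{lo}}}(S)-R,\ R-q_{\epsilon_{\mathrm{up}}}(S)\}$ has a Lebesgue density that is bounded away from zero in a neighborhood of zero. Theorem. Under these assumptions, with $\mathcal L$ denoting Lebesgue measure and $\triangle$ the symmetric difference, $$\mathcal L\Big(\hat C_{\tilde\tau}(S_{n+1})\ \triangle\ [q_{\epsilon_{\mathrm{lo}}}(S_{n+1}),q_{\epsilon_{\mathrm{up}}}(S_{n+1})]\Big)=o_{\mathbb P}(1)\qquad\text{as }n\to\infty,$$ that is, for every $\eta>0$ the probability that the left-hand side is at least $\eta$ tends to $0$. -/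

import Mathlib

open MeasureTheory ProbabilityTheory Filter Topology
open scoped NNReal ENNReal

namespace PACOPP

/-! ### The contextual bandit -/

/-- `p s a` is a version of the conditional density `π(a | s)` of a policy, with respect to a
reference measure `ν s` on the action space (a constant kernel `ν` in the usual case of one fixed
reference measure). -/
structure IsPolicyDensity {𝒮 𝒜 : Type*} [MeasurableSpace 𝒮] [MeasurableSpace 𝒜]
    (ν : Kernel 𝒮 𝒜) (p : 𝒮 → 𝒜 → ℝ≥0) : Prop where
  measurable : Measurable (Function.uncurry p)
  lintegral_eq_one : ∀ s, ∫⁻ a, p s a ∂(ν s) = 1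

/-- The policy `s ↦ π(da | s) = p(s, a) ν(s, da)`. -/
noncomputable def policy {𝒮 𝒜 : Type*} [MeasurableSpace 𝒮] [MeasurableSpace 𝒜]
    (ν : Kernel 𝒮 𝒜) [IsSFiniteKernel ν] (p : 𝒮 → 𝒜 → ℝ≥0) : Kernel 𝒮 𝒜 :=
  Kernel.withDensity ν (fun s a => (p s a : ℝ≥0∞))

/-- The law of `(S, A, R)` when `S ∼ P_S`, `A ∼ π(· | S)`, `R ∼ P_R(· | S, A)`. -/
noncomputable def observationLaw {𝒮 𝒜 : Type*} [MeasurableSpace 𝒮] [MeasurableSpace 𝒜]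
    (PS : Measure 𝒮) (π : Kernel 𝒮 𝒜) (PR : Kernel (𝒮 × 𝒜) ℝ) : Measure (𝒮 × 𝒜 × ℝ) :=
  PS ⊗ₘ (π ⊗ₖ PR)

/-- The conditional law of the reward given the context under the policy `π`:
`s ↦ ∫ P_R(· | s, a) π(da | s)`. -/
noncomputable def rewardKernel {𝒮 𝒜 : Type*} [MeasurableSpace 𝒮] [MeasurableSpace 𝒜]
    (π : Kernel 𝒮 𝒜) (PR : Kernel (𝒮 × 𝒜) ℝ) : Kernel 𝒮 ℝ :=
  (π ⊗ₖ PR).snd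

/-- The joint law `P^π` of `(S, R)` under the policy `π`. -/
noncomputable def contextRewardLaw {𝒮 𝒜 : Type*} [MeasurableSpace 𝒮] [MeasurableSpace 𝒜]
    (PS : Measure 𝒮) (π : Kernel 𝒮 𝒜) (PR : Kernel (𝒮 × 𝒜) ℝ) : Measure (𝒮 × ℝ) :=
  PS ⊗ₘ rewardKernel π PR

/-! ### Quantiles -/

/-- `x` is a quantile of level `p` of the probability measure `μ` on the line. -/
def IsQuantile (μ : Measure ℝ) (p x : ℝ) : Prop :=
  μ.real (Set.Iio x) ≤ p ∧ p ≤ μ.real (Set.Iic x)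

/-- `q` is a version of the conditional quantile function of level `p`, when the context has law
`PS` and the reward has conditional law `κ s` given the context `s`. -/
def IsConditionalQuantile {𝒮 : Type*} [MeasurableSpace 𝒮] (PS : Measure 𝒮) (κ : Kernel 𝒮 ℝ)
    (p : ℝ) (q : 𝒮 → ℝ) : Prop :=
  Measurable q ∧ ∀ᵐ s ∂PS, IsQuantile (κ s) p (q s)

/-! ### Rejection sampling -/

/-- The weight `w(s, a) = π_e(a | s) / π_b(a | s)`, with `0 / 0 = 0`. -/
noncomputable def weight {𝒮 𝒜 : Type*} (pb pe : 𝒮 → 𝒜 → ℝ≥0) (s : 𝒮) (a : 𝒜) : ℝ≥0 :=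
  pe s a / pb s a

/-- The set of all finite `b` with `π_e(a | s) ≤ b π_b(a | s)` for all `(s, a)`. -/
def ratioBounds {𝒮 𝒜 : Type*} (pb pe : 𝒮 → 𝒜 → ℝ≥0) : Set ℝ≥0 :=
  {b | ∀ s a, pe s a ≤ b * pb s a}

/-- The constant `B`, the least of these bounds. -/
noncomputable def ratioBound {𝒮 𝒜 : Type*} (pb pe : 𝒮 → 𝒜 → ℝ≥0) : ℝ≥0 :=
  sInf (ratioBounds pb pe)

/-- The indices `i` that the rejection step keeps: `V_i ≤ w(S_i, A_i) / B`. -/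
noncomputable def acceptedIdx {𝒮 𝒜 : Type*} (pb pe : 𝒮 → 𝒜 → ℝ≥0) {n : ℕ}
    (d : Fin n → 𝒮 × 𝒜 × ℝ) (v : Fin n → ℝ) : Finset (Fin n) :=
  Finset.univ.filter fun i =>
    v i ≤ ((1 / ratioBound pb pe * weight pb pe (d i).1 (d i).2.1 : ℝ≥0) : ℝ)

/-- The entries of the tuple `z` with index in `J`, in increasing order of their indices. -/
def subsample {α : Type*} {N : ℕ} (z : Fin N → α) (J : Finset (Fin N)) : Fin J.card → α :=
  fun j => z (J.orderEmbOfFin rfl j)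

/-- The sample `Z_1, …, Z_N` of pairs `(S_i, R_i)` that survive the rejection step. -/
noncomputable def rejectionSample {𝒮 𝒜 : Type*} (pb pe : 𝒮 → 𝒜 → ℝ≥0) {n : ℕ}
    (d : Fin n → 𝒮 × 𝒜 × ℝ) (v : Fin n → ℝ) : Fin (acceptedIdx pb pe d v).card → 𝒮 × ℝ :=
  subsample (fun i => ((d i).1, (d i).2.2)) (acceptedIdx pb pe d v)

/-! ### Splitting -/

/-- A rule that splits a sample of any size `N` into a training part, with indices in
`split N u`, and a calibration part of size `⌈γ N⌉`, with the remaining indices. The seed `u`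
allows for a randomized split. -/
structure IsSplitRule {𝒰 : Type*} [MeasurableSpace 𝒰] (γ : ℝ)
    (split : (N : ℕ) → 𝒰 → Finset (Fin N)) : Prop where
  card_calibration : ∀ N u, ((split N u)ᶜ).card = ⌈γ * (N : ℝ)⌉₊
  measurableSet_eq : ∀ N J, MeasurableSet {u | split N u = J}

/-! ### The calibrated interval -/

/-- The distribution function of the binomial law `Bin(m, p)` at the integer `x`. -/
noncomputable def binomialCDF (m : ℕ) (p : ℝ) (x : ℤ) : ℝ :=
  ∑ i ∈ (Finset.range (m + 1)).filter (fun i : ℕ => (i : ℤ) ≤ x),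
    (m.choose i : ℝ) * p ^ i * (1 - p) ^ (m - i)

/-- `k(m, ε, δ)`: the largest `k` in `{-1, 0, …, m - 1}` with `F_{Bin(m, ε)}(k) ≤ δ`. -/
noncomputable def kIndex (m : ℕ) (ε δ : ℝ) : ℤ :=
  sSup {k : ℤ | -1 ≤ k ∧ k ≤ (m : ℤ) - 1 ∧ binomialCDF m ε k ≤ δ}

/-- The `i`-th smallest (`1 ≤ i ≤ m`) of the numbers `x_1, …, x_m`; the `(m + 1)`-st is `∞`. -/
noncomputable def orderStat {m : ℕ} (x : Fin m → ℝ) (i : ℕ) : EReal :=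
  if h : 1 ≤ i ∧ i ≤ m then ((x (Tuple.sort x ⟨i - 1, by omega⟩) : ℝ) : EReal) else ⊤

/-- The non-conformity score of `z = (s, r)`. -/
def score {𝒮 : Type*} (qlo qup : 𝒮 → ℝ) (z : 𝒮 × ℝ) : ℝ :=
  max (qlo z.1 - z.2) (z.2 - qup z.1)

/-- The threshold: the `(m - k(m, ε, δ))`-th smallest of the `m` scores. -/
noncomputable def pacThreshold (ε δ : ℝ) {m : ℕ} (x : Fin m → ℝ) : EReal :=
  orderStat x ((m : ℤ) - kIndex m ε δ).toNat

/-- The interval `[qlo(s) - τ, qup(s) + τ]`, which is all of `ℝ` for `τ = ∞`. -/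
def predInterval {𝒮 : Type*} (qlo qup : 𝒮 → ℝ) (τ : EReal) (s : 𝒮) : Set ℝ :=
  {r | (qlo s : EReal) - τ ≤ (r : EReal) ∧ (r : EReal) ≤ (qup s : EReal) + τ}

/-- The calibration step: the interval at the context `s`, from fitted quantile functions and
calibration data. -/
noncomputable def pacCP {𝒮 : Type*} (ε δ : ℝ) (qlo qup : 𝒮 → ℝ) {m : ℕ} (cal : Fin m → 𝒮 × ℝ)
    (s : 𝒮) : Set ℝ :=
  predInterval qlo qup (pacThreshold ε δ (fun j => score qlo qup (cal j))) s

/-- The output of the algorithm at the test context `s`: rejection sampling with the uniform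
variables `v`, splitting with the seed `u`, fitting the quantile functions on the training part by
the (deterministic) procedures `qloHat`, `qupHat`, calibrating on the remaining part. -/
noncomputable def pacopp {𝒮 𝒜 𝒰 : Type*} (pb pe : 𝒮 → 𝒜 → ℝ≥0) (ε δ : ℝ)
    (split : (N : ℕ) → 𝒰 → Finset (Fin N))
    (qloHat qupHat : (l : ℕ) → (Fin l → 𝒮 × ℝ) → 𝒮 → ℝ)
    {n : ℕ} (d : Fin n → 𝒮 × 𝒜 × ℝ) (v : Fin n → ℝ) (u : 𝒰) (s : 𝒮) : Set ℝ :=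
  let z := rejectionSample pb pe d v
  let J := split _ u
  let train := subsample z J
  let cal := subsample z Jᶜ
  pacCP ε δ (qloHat _ train) (qupHat _ train) cal s

/-! ### Standing assumptions -/

/-- The random experiment. `D i` are i.i.d. observations with law `Pobs`, `V i` are i.i.d. uniform
on `[0, 1]` and independent of the observations. For each sample size `n`, the test context `X n`
has law `PS` and is independent of the first `n` observations and uniforms, and the seed `U n` of
the split is independent of all of these. -/
structure IsExperiment {Ω 𝒮 𝒜 𝒰 : Type*} [MeasurableSpace Ω] [MeasurableSpace 𝒮]
    [MeasurableSpace 𝒜] [MeasurableSpace 𝒰] (P : Measure Ω) (PS : Measure 𝒮)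
    (Pobs : Measure (𝒮 × 𝒜 × ℝ)) (D : ℕ → Ω → 𝒮 × 𝒜 × ℝ) (V : ℕ → Ω → ℝ) (X : ℕ → Ω → 𝒮)
    (U : ℕ → Ω → 𝒰) : Prop where
  measurable_D : ∀ i, Measurable (D i)
  measurable_V : ∀ i, Measurable (V i)
  measurable_X : ∀ n, Measurable (X n)
  measurable_U : ∀ n, Measurable (U n)
  law_D : ∀ i, P.map (D i) = Pobs
  law_V : ∀ i, P.map (V i) = volume.restrict (Set.Icc (0 : ℝ) 1)
  law_X : ∀ n, P.map (X n) = PS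
  indep_D : iIndepFun D P
  indep_V : iIndepFun V P
  indep_D_V : IndepFun (fun ω i => D i ω) (fun ω i => V i ω) P
  indep_X : ∀ n, IndepFun (X n)
    (fun ω => ((fun i : Fin n => D i ω), (fun i : Fin n => V i ω))) P
  indep_U : ∀ n, IndepFun (U n)
    (fun ω => (X n ω, (fun i : Fin n => D i ω), (fun i : Fin n => V i ω))) P

/-- Consistency of the quantile estimates: for a training set `t` of `l` i.i.d. draws from `Q`, the
mean squared errors `E[(q̂(S) - q(S))² | t]`, `S ∼ PS` independent of `t`, are both at most
`η_l / 2` with probability at least `1 - ρ_l / 2` each, for all large `l`, where `η_l → 0` and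
`ρ_l → 0`. -/
def QuantileConsistency {𝒮 : Type*} [MeasurableSpace 𝒮] (PS : Measure 𝒮) (Q : Measure (𝒮 × ℝ))
    (qloHat qupHat : (l : ℕ) → (Fin l → 𝒮 × ℝ) → 𝒮 → ℝ) (qlo qup : 𝒮 → ℝ) : Prop :=
  ∃ η ρ : ℕ → ℝ, Tendsto η atTop (𝓝 0) ∧ Tendsto ρ atTop (𝓝 0) ∧
    ∀ᶠ l in atTop,
      1 - ρ l / 2 ≤ (Measure.pi (fun _ : Fin l => Q)).real
        {t | ∫⁻ s, ENNReal.ofReal ((qloHat l t s - qlo s) ^ 2) ∂PS ≤ ENNReal.ofReal (η l / 2)} ∧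
      1 - ρ l / 2 ≤ (Measure.pi (fun _ : Fin l => Q)).real
        {t | ∫⁻ s, ENNReal.ofReal ((qupHat l t s - qup s) ^ 2) ∂PS ≤ ENNReal.ofReal (η l / 2)}

/-- The law `μ` has a Lebesgue density that is bounded away from zero in a neighborhood of zero. -/
def DensityPositiveNearZero (μ : Measure ℝ) : Prop :=
  ∃ f : ℝ → ℝ≥0∞, Measurable f ∧ μ = volume.withDensity f ∧
    ∃ c : ℝ≥0∞, 0 < c ∧ ∀ᶠ t in 𝓝 (0 : ℝ), c ≤ f t

end PACOPP

namespace PACOPP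

/-! ### The index `k(m, ε, δ)` -/

/-! The threshold converges to zero in probability; together with consistent endpoints this makes
the symmetric difference small.

The oracle score `T` satisfies P(T ≤ 0) = 1 - ε: given the context, the closed interval between the
two quantiles has mass at least 1 - ε, the open one has at most that mass, and `T` has no atom at
zero (`compProd_score_le_zero`). The density bound makes the distribution function of `T` cross the
level 1 - ε with slope at least some c > 0 (`exists_Ioc_ge`). By Chebyshev, `kIndex m ε δ / m` tends
to ε (`eventually_kIndex_bounds`), so the threshold is an empirical quantile of level close to 1 -
ε. Fitted and oracle scores differ by less than β except on a set of contexts of small probability.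
Comparing counts of scores below ±2β with their means therefore puts the threshold in (-2β, 2β] with
high probability (`pi_badCalibration_le`), and each endpoint is then off by less than 3β. This
settles training and calibration samples of fixed large sizes, uniformly in the sizes
(`exists_forall_prod_pacCP_le`).

The random sizes are handled by conditioning. Keeping an observation with probability w/B turns the
density π_b into π_e/B (`measure_acceptRegion_inter`), so given the set of kept indices the kept
pairs are i.i.d. from the target law (`pi_selected_inter_subsample`). Given also the seed, the two
parts of the split are independent i.i.d. samples. Summing over index sets and splits transfers the
fixed-size bound (`prod_selected_split_le`). The number of kept pairs tends to infinity in
probability, since each is kept with probability 1/B > 0. -/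

lemma sum_binomial_le_of_far {m : ℕ} (hm : m ≠ 0) {p κ : ℝ} (hp : p ∈ Set.Icc (0 : ℝ) 1)
    (hκ : 0 < κ) (A : Finset ℕ) (hA : A ⊆ Finset.range (m + 1))
    (hfar : ∀ i ∈ A, κ * m ≤ |p * m - i|) :
    ∑ i ∈ A, (m.choose i : ℝ) * p ^ i * (1 - p) ^ (m - i) ≤ 1 / (m * κ ^ 2) := by
  have hm0 : (0 : ℝ) < m := by positivity
  -- Chebyshev's inequality for i/m; the variance is that of the Bernstein polynomial weights.
  have hvar : ∑ i ∈ Finset.range (m + 1),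
      (p - i / m) ^ 2 * ((m.choose i : ℝ) * p ^ i * (1 - p) ^ (m - i)) = p * (1 - p) / m := by
    rw [← bernstein.variance hm ⟨p, hp⟩, Finset.sum_range]
    simp [bernstein_apply, bernstein.z]
  have hnn : ∀ i, 0 ≤ (m.choose i : ℝ) * p ^ i * (1 - p) ^ (m - i) := fun i =>
    mul_nonneg (mul_nonneg (by positivity) (pow_nonneg hp.1 _))
      (pow_nonneg (by linarith [hp.2]) _)
  have h1 : κ ^ 2 * ∑ i ∈ A, (m.choose i : ℝ) * p ^ i * (1 - p) ^ (m - i) ≤ 1 / m := by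
    calc κ ^ 2 * ∑ i ∈ A, (m.choose i : ℝ) * p ^ i * (1 - p) ^ (m - i)
        = ∑ i ∈ A, κ ^ 2 * ((m.choose i : ℝ) * p ^ i * (1 - p) ^ (m - i)) := Finset.mul_sum ..
      _ ≤ ∑ i ∈ A, (p - i / m) ^ 2 * ((m.choose i : ℝ) * p ^ i * (1 - p) ^ (m - i)) := by
          refine Finset.sum_le_sum fun i hi => mul_le_mul_of_nonneg_right ?_ (hnn i)
          rw [← sq_abs (p - i / m)]
          refine pow_le_pow_left₀ hκ.le ?_ 2
          have : p - i / m = (p * m - i) / m := by field_simp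
          rw [this, abs_div, abs_of_pos hm0, le_div_iff₀ hm0]
          exact hfar i hi
      _ ≤ ∑ i ∈ Finset.range (m + 1),
            (p - i / m) ^ 2 * ((m.choose i : ℝ) * p ^ i * (1 - p) ^ (m - i)) :=
          Finset.sum_le_sum_of_subset_of_nonneg hA fun i _ _ => mul_nonneg (sq_nonneg _) (hnn i)
      _ = p * (1 - p) / m := hvar
      _ ≤ 1 / m := by
          gcongr
          nlinarith [hp.1, hp.2]
  rw [le_div_iff₀ (by positivity)]
  rw [le_div_iff₀ hm0] at h1
  linarith

lemma binomialCDF_le {m : ℕ} (hm : m ≠ 0) {p κ : ℝ} (hp : p ∈ Set.Icc (0 : ℝ) 1) (hκ : 0 < κ)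
    {x : ℤ} (hx : (x : ℝ) ≤ (p - κ) * m) : binomialCDF m p x ≤ 1 / (m * κ ^ 2) := by
  refine sum_binomial_le_of_far hm hp hκ _ (Finset.filter_subset _ _) fun i hi => ?_
  have hi' : (i : ℤ) ≤ x := (Finset.mem_filter.1 hi).2
  have : (i : ℝ) ≤ x := by exact_mod_cast hi'
  exact le_trans (by linarith) (le_abs_self _)

lemma le_binomialCDF {m : ℕ} (hm : m ≠ 0) {p κ : ℝ} (hp : p ∈ Set.Icc (0 : ℝ) 1) (hκ : 0 < κ)
    {x : ℤ} (hx : (p + κ) * m ≤ x) : 1 - 1 / (m * κ ^ 2) ≤ binomialCDF m p x := by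
  have htot : ∑ i ∈ Finset.range (m + 1), (m.choose i : ℝ) * p ^ i * (1 - p) ^ (m - i) = 1 := by
    have := bernstein.probability m ⟨p, hp⟩
    rw [Finset.sum_range]
    simpa [bernstein_apply] using this
  rw [← Finset.sum_filter_add_sum_filter_not (Finset.range (m + 1)) (fun i : ℕ => (i : ℤ) ≤ x)]
    at htot
  have := sum_binomial_le_of_far hm hp hκ
    ((Finset.range (m + 1)).filter fun i : ℕ => ¬ (i : ℤ) ≤ x) (Finset.filter_subset _ _)
    fun i hi => by
      have hi' : x < (i : ℤ) := not_le.1 (Finset.mem_filter.1 hi).2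
      have : (x : ℝ) < i := by exact_mod_cast hi'
      rw [abs_sub_comm]
      exact le_trans (by linarith) (le_abs_self _)
  unfold binomialCDF
  linarith

lemma isGreatest_kIndex (m : ℕ) {ε δ : ℝ} (hδ : 0 < δ) :
    IsGreatest {k : ℤ | -1 ≤ k ∧ k ≤ (m : ℤ) - 1 ∧ binomialCDF m ε k ≤ δ} (kIndex m ε δ) := by
  -- The index -1 is always admissible (empty sum), so the supremum is a genuine maximum and not a
  -- default value.
  have hne : (-1 : ℤ) ∈ {k : ℤ | -1 ≤ k ∧ k ≤ (m : ℤ) - 1 ∧ binomialCDF m ε k ≤ δ} := by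
    refine ⟨le_rfl, by omega, ?_⟩
    have : (Finset.range (m + 1)).filter (fun i : ℕ => (i : ℤ) ≤ -1) = ∅ := by
      ext i; simp; omega
    simp [binomialCDF, this, hδ.le]
  have hbdd : BddAbove {k : ℤ | -1 ≤ k ∧ k ≤ (m : ℤ) - 1 ∧ binomialCDF m ε k ≤ δ} :=
    ⟨(m : ℤ) - 1, fun k hk => hk.2.1⟩
  exact ⟨Int.csSup_mem ⟨_, hne⟩ hbdd, fun k hk => le_csSup hbdd hk⟩

/-- If k were below (ε - κ)m, then k + 1 would still lie in the lower tail and be admissible,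
against maximality. If k were above (ε + κ)m, the distribution function at k would be close to 1 and
exceed δ. -/
lemma eventually_kIndex_bounds {ε δ κ : ℝ} (hε : ε ∈ Set.Ioo (0 : ℝ) 1)
    (hδ : δ ∈ Set.Ioo (0 : ℝ) 1) (hκ : 0 < κ) :
    ∀ᶠ m : ℕ in atTop,
      (ε - κ) * m ≤ kIndex m ε δ ∧ (kIndex m ε δ : ℝ) ≤ (ε + κ) * m := by
  have hε' : ε ∈ Set.Icc (0 : ℝ) 1 := ⟨hε.1.le, hε.2.le⟩
  have ht : ∀ c : ℝ, ∀ᶠ m : ℕ in atTop, c ≤ m := fun c => by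
    filter_upwards [eventually_ge_atTop ⌈c⌉₊] with m hm using Nat.ceil_le.1 hm
  -- The first bound absorbs the step from k to k + 1 into κm/2, the second keeps k + 1 ≤ m - 1, and
  -- the last two push the Chebyshev errors strictly below δ and 1 - δ.
  filter_upwards [ht (2 / κ), ht (2 / (1 - ε)), ht (1 + 1 / (δ * (κ / 2) ^ 2)),
    ht (1 + 1 / ((1 - δ) * κ ^ 2)), eventually_ne_atTop 0] with m h1 h2 h3 h4 hm
  have hm0 : (0 : ℝ) < m := by positivity
  have hδ1 : 0 < 1 - δ := by linarith [hδ.2]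
  have hε1 : 0 < 1 - ε := by linarith [hε.2]
  have hδ0 : 0 < δ := hδ.1
  obtain ⟨⟨hk1, hk2, hk3⟩, hk4⟩ := isGreatest_kIndex m (ε := ε) hδ.1
  rw [div_le_iff₀ hκ] at h1
  rw [div_le_iff₀ hε1] at h2
  constructor
  · by_contra! hlt
    have hk5 : ((kIndex m ε δ + 1 : ℤ) : ℝ) ≤ (ε - κ / 2) * m := by push_cast; linarith
    have hk6 : kIndex m ε δ + 1 ≤ (m : ℤ) - 1 := by
      have : ((kIndex m ε δ + 1 : ℤ) : ℝ) ≤ ((m : ℤ) - 1 : ℤ) := by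
        push_cast at hk5 ⊢
        nlinarith
      exact_mod_cast this
    have hk7 : δ < binomialCDF m ε (kIndex m ε δ + 1) := by
      by_contra! hle
      have := hk4 ⟨by omega, hk6, hle⟩
      omega
    have hk8 := binomialCDF_le hm hε' (half_pos hκ) hk5
    have : 1 / (m * (κ / 2) ^ 2) < δ := by
      rw [div_lt_iff₀ (by positivity)]
      have h3' : 1 / (δ * (κ / 2) ^ 2) < m := by linarith
      rw [div_lt_iff₀ (by positivity)] at h3'
      linarith
    linarith
  · by_contra! hlt
    have hk8 := le_binomialCDF hm hε' hκ hlt.le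
    have : 1 / (m * κ ^ 2) < 1 - δ := by
      rw [div_lt_iff₀ (by positivity)]
      have h4' : 1 / ((1 - δ) * κ ^ 2) < m := by linarith
      rw [div_lt_iff₀ (by positivity)] at h4'
      linarith
    linarith

/-! ### Order statistics -/

lemma card_filter_comp_perm {m : ℕ} (σ : Equiv.Perm (Fin m)) (q : Fin m → Prop)
    [DecidablePred q] :
    (Finset.univ.filter fun i => q (σ i)).card = (Finset.univ.filter q).card :=
  Finset.card_bij (fun i _ => σ i) (by simp) (by simp)
    fun j hj => ⟨σ.symm j, by simpa using hj, by simp⟩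

/-- Trades sorting for counting: everything later needed about order statistics becomes a statement
on sums of i.i.d. indicators. -/
lemma exists_orderStat_eq {m : ℕ} (x : Fin m → ℝ) {i : ℕ} (h1 : 1 ≤ i) (hi : i ≤ m) :
    ∃ τ : ℝ, orderStat x i = τ ∧
      ∀ a : ℝ, τ ≤ a ↔ i ≤ (Finset.univ.filter fun j => x j ≤ a).card := by
  refine ⟨x (Tuple.sort x ⟨i - 1, by omega⟩), by simp [orderStat, h1, hi], fun a => ?_⟩
  have := Tuple.lt_card_le_iff_apply_le_of_monotone (j := ⟨i - 1, by omega⟩) (a := a)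
    (Tuple.monotone_sort x)
  simp only [Function.comp_apply] at this
  rw [← this, card_filter_comp_perm (Tuple.sort x) (fun j => x j ≤ a)]
  omega

/-! ### Intervals -/

lemma predInterval_coe {𝒮 : Type*} (qlo qup : 𝒮 → ℝ) (τ : ℝ) (s : 𝒮) :
    predInterval qlo qup (τ : EReal) s = Set.Icc (qlo s - τ) (qup s + τ) := by
  ext r
  simp only [predInterval, Set.mem_ofPred_eq, Set.mem_Icc]
  norm_cast

/-- A point of exactly one interval lies between the two left endpoints or between the two right
ones. This remains true when an interval is empty, so crossing endpoints need no separate case. -/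
lemma volume_symmDiff_Icc_le (a b c d : ℝ) :
    volume (symmDiff (Set.Icc a b) (Set.Icc c d)) ≤ ENNReal.ofReal (|a - c| + |b - d|) := by
  have hsub : symmDiff (Set.Icc a b) (Set.Icc c d) ⊆ Set.uIcc a c ∪ Set.uIcc b d := by
    intro r hr
    simp only [Set.mem_symmDiff, Set.mem_Icc, not_and_or, not_le] at hr
    simp only [Set.mem_union, Set.mem_uIcc]
    grind
  calc volume (symmDiff (Set.Icc a b) (Set.Icc c d))
      ≤ volume (Set.uIcc a c ∪ Set.uIcc b d) := measure_mono hsub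
    _ ≤ volume (Set.uIcc a c) + volume (Set.uIcc b d) := measure_union_le _ _
    _ = ENNReal.ofReal (|a - c| + |b - d|) := by
        rw [Real.volume_interval, Real.volume_interval, ← ENNReal.ofReal_add (abs_nonneg _) (abs_nonneg _),
          abs_sub_comm a c, abs_sub_comm b d]

/-! ### Counts of an i.i.d. sample -/

lemma measurable_card_filter {α : Type*} [MeasurableSpace α] {m : ℕ} (S : Fin m → Set α)
    [∀ j x, Decidable (x ∈ S j)] (hS : ∀ j, MeasurableSet (S j)) :
    Measurable fun x : α => ((Finset.univ.filter fun j => x ∈ S j).card : ℝ) := by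
  have : (fun x : α => ((Finset.univ.filter fun j => x ∈ S j).card : ℝ))
      = fun x => ∑ j, (S j).indicator (fun _ => (1 : ℝ)) x := by
    ext x
    simp [Set.indicator_apply, Finset.sum_boole]
  rw [this]
  exact Finset.measurable_sum _ fun j _ => measurable_const.indicator (hS j)

/-- Chebyshev's inequality, with the variance of an indicator crudely bounded by 1. -/
lemma pi_abs_card_sub_ge_le {α : Type*} [MeasurableSpace α] (μ : Measure α)
    [IsProbabilityMeasure μ] {S : Set α} [DecidablePred (· ∈ S)] (hS : MeasurableSet S)
    {m : ℕ} (hm : m ≠ 0) {κ : ℝ} (hκ : 0 < κ) :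
    (Measure.pi fun _ : Fin m => μ)
      {x | κ * m ≤ |((Finset.univ.filter fun j => x j ∈ S).card : ℝ) - m * μ.real S|}
      ≤ ENNReal.ofReal (1 / (m * κ ^ 2)) := by
  have hm0 : (0 : ℝ) < m := by positivity
  set Z : α → ℝ := S.indicator fun _ => (1 : ℝ) with hZ
  have hZm : Measurable Z := measurable_const.indicator hS
  have hZ01 : ∀ a, Z a ∈ Set.Icc (0 : ℝ) 1 := fun a => by
    by_cases h : a ∈ S <;> simp [hZ, h]
  have hZL : MemLp Z 2 μ := MemLp.of_bound hZm.aestronglyMeasurable 1 (ae_of_all _ fun a => by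
    rw [Real.norm_eq_abs, abs_of_nonneg (hZ01 a).1]; exact (hZ01 a).2)
  have hcount : ∀ x : Fin m → α, ((Finset.univ.filter fun j => x j ∈ S).card : ℝ)
      = (∑ j : Fin m, fun y : Fin m → α => Z (y j)) x := fun x => by
    simp [hZ, Set.indicator_apply, Finset.sum_boole]
  have hmp : ∀ j : Fin m, MeasurePreserving (Function.eval j)
      (Measure.pi fun _ : Fin m => μ) μ := fun j => measurePreserving_eval _ j
  have hL : ∀ j : Fin m, MemLp (fun y : Fin m → α => Z (y j)) 2 (Measure.pi fun _ : Fin m => μ) :=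
    fun j => hZL.comp_measurePreserving (hmp j)
  have hsumL : MemLp (∑ j : Fin m, fun y : Fin m → α => Z (y j)) 2
      (Measure.pi fun _ : Fin m => μ) := memLp_finsetSum' _ fun j _ => hL j
  have hint : ∫ x, (∑ j : Fin m, fun y : Fin m → α => Z (y j)) x
      ∂(Measure.pi fun _ : Fin m => μ) = m * μ.real S := by
    simp only [Finset.sum_apply]
    rw [integral_finsetSum _ fun j _ => (hL j).integrable (by norm_num)]
    have : ∀ j : Fin m, ∫ y : Fin m → α, Z (y j) ∂(Measure.pi fun _ : Fin m => μ) = μ.real S := by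
      intro j
      have := integral_map (μ := Measure.pi fun _ : Fin m => μ) (hmp j).measurable.aemeasurable
        (f := Z) hZm.aestronglyMeasurable
      rw [(hmp j).map_eq] at this
      simp only [Function.eval] at this
      rw [← this, hZ, integral_indicator_const _ hS]
      simp
    simp [this]
  have hvar : Var[∑ j : Fin m, fun y : Fin m → α => Z (y j); Measure.pi fun _ : Fin m => μ]
      ≤ m := by
    rw [variance_sum_pi fun _ => hZL]
    calc ∑ _j : Fin m, Var[Z; μ] ≤ ∑ _j : Fin m, (1 : ℝ) := by
          refine Finset.sum_le_sum fun j _ => ?_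
          refine (variance_le_sq_of_bounded (ae_of_all _ hZ01) hZm.aemeasurable).trans ?_
          norm_num
      _ = m := by simp
  have hch := meas_ge_le_variance_div_sq hsumL (c := κ * m) (by positivity)
  rw [hint] at hch
  simp_rw [hcount]
  refine hch.trans (ENNReal.ofReal_le_ofReal ?_)
  calc _ ≤ (m : ℝ) / (κ * m) ^ 2 := by gcongr
    _ = 1 / (m * κ ^ 2) := by field_simp

/-! ### The law of the oracle score -/

lemma IsQuantile.le_measureReal_Icc {μ : Measure ℝ} [IsFiniteMeasure μ] {p p' a b : ℝ}
    (ha : IsQuantile μ p a) (hb : IsQuantile μ p' b) : p' - p ≤ μ.real (Set.Icc a b) := by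
  have hsub : Set.Iic b ⊆ Set.Iio a ∪ Set.Icc a b := fun r hr => by
    rcases lt_or_ge r a with h | h
    · exact Or.inl h
    · exact Or.inr ⟨h, hr⟩
  have h1 := measureReal_mono (μ := μ) hsub
  have h2 := measureReal_union_le (μ := μ) (Set.Iio a) (Set.Icc a b)
  linarith [ha.1, hb.2]

lemma IsQuantile.measureReal_Ioo_le {μ : Measure ℝ} [IsFiniteMeasure μ] {p p' a b : ℝ}
    (ha : IsQuantile μ p a) (hb : IsQuantile μ p' b) (hp : p ≤ p') :
    μ.real (Set.Ioo a b) ≤ p' - p := by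
  rcases lt_or_ge a b with hab | hab
  · have h2 := measureReal_union (μ := μ) (s₁ := Set.Iic a) (s₂ := Set.Ioo a b)
      (Set.disjoint_left.2 fun r hr hr' => not_lt.2 hr hr'.1) measurableSet_Ioo
    have h1 : μ.real (Set.Iic a ∪ Set.Ioo a b) ≤ μ.real (Set.Iio b) :=
      measureReal_mono (Set.union_subset (fun r hr => lt_of_le_of_lt hr hab) fun r hr => hr.2)
    linarith [ha.2, hb.1]
  · simpa [Set.Ioo_eq_empty (not_lt.2 hab)] using hp

lemma measurable_score {𝒮 : Type*} [MeasurableSpace 𝒮] {qlo qup : 𝒮 → ℝ} (hlo : Measurable qlo)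
    (hup : Measurable qup) : Measurable (score qlo qup) := by
  unfold score
  fun_prop

/-- Integrating the two conditional bounds over the context gives P(T < 0) ≤ p' - p ≤ P(T ≤ 0); the
absence of an atom at zero closes the gap. -/
lemma compProd_score_le_zero {𝒮 : Type*} [MeasurableSpace 𝒮] {PS : Measure 𝒮}
    [IsProbabilityMeasure PS] {κ : Kernel 𝒮 ℝ} [IsMarkovKernel κ] {p p' : ℝ} {qlo qup : 𝒮 → ℝ}
    (hlo : IsConditionalQuantile PS κ p qlo) (hup : IsConditionalQuantile PS κ p' qup)
    (hp : p ≤ p') (hatom : (PS ⊗ₘ κ) {z | score qlo qup z = 0} = 0) :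
    (PS ⊗ₘ κ).real {z | score qlo qup z ≤ 0} = p' - p := by
  have hT := measurable_score hlo.1 hup.1
  have hle : ENNReal.ofReal (p' - p) ≤ (PS ⊗ₘ κ) {z | score qlo qup z ≤ 0} := by
    rw [Measure.compProd_apply (measurableSet_le hT measurable_const)]
    calc ENNReal.ofReal (p' - p) = ∫⁻ _, ENNReal.ofReal (p' - p) ∂PS := by simp
      _ ≤ _ := by
        refine lintegral_mono_ae ?_
        filter_upwards [hlo.2, hup.2] with s h1 h2
        refine (ENNReal.ofReal_le_iff_le_toReal (measure_ne_top _ _)).2 ?_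
        refine (h1.le_measureReal_Icc h2).trans (measureReal_mono ?_)
        rintro r ⟨hr1, hr2⟩
        simp only [Set.mem_preimage, Set.mem_ofPred_eq, score]
        exact max_le (by linarith) (by linarith)
  have hge : (PS ⊗ₘ κ) {z | score qlo qup z < 0} ≤ ENNReal.ofReal (p' - p) := by
    rw [Measure.compProd_apply (measurableSet_lt hT measurable_const)]
    calc _ ≤ ∫⁻ _, ENNReal.ofReal (p' - p) ∂PS := by
          refine lintegral_mono_ae ?_
          filter_upwards [hlo.2, hup.2] with s h1 h2
          refine (ENNReal.le_ofReal_iff_toReal_le (measure_ne_top _ _) (by linarith)).2 ?_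
          refine le_trans (measureReal_mono ?_) (h1.measureReal_Ioo_le h2 hp)
          intro r hr
          simp only [Set.mem_preimage, Set.mem_ofPred_eq, score, max_lt_iff] at hr
          exact ⟨by linarith [hr.1], by linarith [hr.2]⟩
      _ = _ := by simp
  have hge' : (PS ⊗ₘ κ) {z | score qlo qup z ≤ 0} ≤ ENNReal.ofReal (p' - p) := by
    have hsub : {z | score qlo qup z ≤ 0} ⊆ {z | score qlo qup z < 0} ∪ {z | score qlo qup z = 0} :=
      fun z hz => by
        simpa only [Set.mem_union, Set.mem_ofPred_eq] using lt_or_eq_of_le (Set.mem_ofPred.1 hz)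
    refine (measure_mono hsub).trans ((measure_union_le _ _).trans ?_)
    rw [hatom, add_zero]
    exact hge
  rw [measureReal_def, le_antisymm hge' hle, ENNReal.toReal_ofReal (by linarith)]

lemma DensityPositiveNearZero.measure_singleton {μ : Measure ℝ} (h : DensityPositiveNearZero μ)
    (x : ℝ) : μ {x} = 0 := by
  obtain ⟨f, hf, rfl, -⟩ := h
  exact withDensity_absolutelyContinuous _ _ Real.volume_singleton

lemma DensityPositiveNearZero.exists_Ioc_ge {μ : Measure ℝ} [IsFiniteMeasure μ]
    (h : DensityPositiveNearZero μ) :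
    ∃ c > 0, ∃ b > 0, ∀ x y : ℝ, -b < x → x ≤ y → y < b → c * (y - x) ≤ μ.real (Set.Ioc x y) := by
  obtain ⟨f, hf, hμ, c, hc, hev⟩ := h
  obtain ⟨b, hb, hball⟩ := Metric.eventually_nhds_iff.1 hev
  -- The lower bound on the density may be infinite; truncation at 1 makes it a real constant.
  have hc1 : min c 1 ≠ ⊤ := ne_top_of_le_ne_top ENNReal.one_ne_top (min_le_right _ _)
  refine ⟨(min c 1).toReal, ENNReal.toReal_pos (by simp [hc.ne']) hc1, b, hb,
    fun x y hx hxy hy => ?_⟩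
  have : min c 1 * ENNReal.ofReal (y - x) ≤ μ (Set.Ioc x y) := by
    rw [hμ, withDensity_apply _ measurableSet_Ioc, ← Real.volume_Ioc, ← setLIntegral_const]
    refine setLIntegral_mono hf fun t ht => (min_le_left _ _).trans (hball ?_)
    rw [Real.dist_eq, sub_zero, abs_lt]
    exact ⟨hx.trans ht.1, ht.2.trans_lt hy⟩
  have h2 := ENNReal.toReal_mono (measure_ne_top _ _) this
  rwa [ENNReal.toReal_mul, ENNReal.toReal_ofReal (by linarith)] at h2

/-! ### Calibration with nearly exact quantiles -/

/-- The calibration samples for which the threshold is not in `(-β, β]`, when it is the `i`-th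
smallest score. -/
def badCalibration {𝒮 : Type*} (qlo qup : 𝒮 → ℝ) (β : ℝ) (m i : ℕ) : Set (Fin m → 𝒮 × ℝ) :=
  {c | i ≤ (Finset.univ.filter fun j => score qlo qup (c j) ≤ -β).card ∨
    (Finset.univ.filter fun j => score qlo qup (c j) ≤ β).card < i}

/-- The contexts at which one of two pairs of functions differs by at least `β`. -/
def badContext {𝒮 : Type*} (a b qlo qup : 𝒮 → ℝ) (β : ℝ) : Set 𝒮 :=
  {s | β ≤ |a s - qlo s|} ∪ {s | β ≤ |b s - qup s|}

lemma exists_orderStat_of_notMem_badCalibration {𝒮 : Type*} {qlo qup : 𝒮 → ℝ} {β : ℝ} {m i : ℕ}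
    (hi : 1 ≤ i) {c : Fin m → 𝒮 × ℝ} (hc : c ∉ badCalibration qlo qup β m i) :
    ∃ τ : ℝ, orderStat (fun j => score qlo qup (c j)) i = τ ∧ |τ| ≤ β := by
  simp only [badCalibration, Set.mem_ofPred_eq, not_or, not_le, not_lt] at hc
  -- At least i of the m scores are at most β, which excludes the default value ∞ of the order
  -- statistic.
  have him : i ≤ m := hc.2.trans ((Finset.card_le_univ _).trans_eq (by simp))
  obtain ⟨τ, hτ, hτ'⟩ := exists_orderStat_eq (fun j => score qlo qup (c j)) hi him
  refine ⟨τ, hτ, abs_le.2 ⟨?_, (hτ' β).2 hc.2⟩⟩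
  by_contra! hlt
  exact absurd ((hτ' (-β)).1 hlt.le) (not_le.2 hc.1)

lemma abs_score_sub_lt {𝒮 : Type*} {a b qlo qup : 𝒮 → ℝ} {β : ℝ} {z : 𝒮 × ℝ}
    (hz : z.1 ∉ badContext a b qlo qup β) : |score a b z - score qlo qup z| < β := by
  simp only [badContext, Set.mem_union, Set.mem_ofPred_eq, not_or, not_le] at hz
  refine (abs_max_sub_max_le_max _ _ _ _).trans_lt (max_lt ?_ ?_)
  · rw [show a z.1 - z.2 - (qlo z.1 - z.2) = a z.1 - qlo z.1 by ring]
    exact hz.1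
  · rw [show z.2 - b z.1 - (z.2 - qup z.1) = -(b z.1 - qup z.1) by ring, abs_neg]
    exact hz.2

lemma measurableSet_badContext {𝒮 : Type*} [MeasurableSpace 𝒮] {a b qlo qup : 𝒮 → ℝ}
    (ha : Measurable a) (hb : Measurable b) (hlo : Measurable qlo) (hup : Measurable qup) (β : ℝ) :
    MeasurableSet (badContext a b qlo qup β) :=
  (measurableSet_le measurable_const (by fun_prop)).union
    (measurableSet_le measurable_const (by fun_prop))

lemma measure_abs_sub_ge_le {𝒮 : Type*} [MeasurableSpace 𝒮] {PS : Measure 𝒮} {a q : 𝒮 → ℝ}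
    (ha : Measurable a) (hq : Measurable q) {β e : ℝ} (hβ : 0 < β)
    (h : ∫⁻ s, ENNReal.ofReal ((a s - q s) ^ 2) ∂PS ≤ ENNReal.ofReal e) :
    PS {s | β ≤ |a s - q s|} ≤ ENNReal.ofReal (e / β ^ 2) := by
  have hm : Measurable fun s => ENNReal.ofReal ((a s - q s) ^ 2) := by fun_prop
  have hmk := mul_meas_ge_le_lintegral₀ (μ := PS) hm.aemeasurable (ENNReal.ofReal (β ^ 2))
  have hset : {s | β ≤ |a s - q s|} ⊆
      {s | ENNReal.ofReal (β ^ 2) ≤ ENNReal.ofReal ((a s - q s) ^ 2)} := fun s hs => by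
    refine ENNReal.ofReal_le_ofReal ?_
    rw [← sq_abs (a s - q s)]
    exact pow_le_pow_left₀ hβ.le hs 2
  rw [ENNReal.ofReal_div_of_pos (by positivity)]
  refine (ENNReal.le_div_iff_mul_le (Or.inl (by simp; positivity))
    (Or.inl ENNReal.ofReal_ne_top)).2 ?_
  rw [mul_comm]
  exact (mul_le_mul_right (measure_mono hset) _).trans (hmk.trans h)

lemma measureReal_score_le_le {𝒮 : Type*} [MeasurableSpace 𝒮] {Q : Measure (𝒮 × ℝ)}
    [IsFiniteMeasure Q] {a b qlo qup : 𝒮 → ℝ} (ha : Measurable a) (hb : Measurable b)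
    (hlo : Measurable qlo) (hup : Measurable qup) {β : ℝ} (x : ℝ) :
    Q.real {z | score a b z ≤ x} ≤ Q.real {z | score qlo qup z ≤ x + β}
      + Q.fst.real (badContext a b qlo qup β) := by
  have hsub : {z | score a b z ≤ x} ⊆
      {z | score qlo qup z ≤ x + β} ∪ Prod.fst ⁻¹' badContext a b qlo qup β := fun z hz => by
    by_cases hz' : z.1 ∈ badContext a b qlo qup β
    · exact Or.inr hz'
    · refine Or.inl ?_
      have := (abs_lt.1 (abs_score_sub_lt hz')).1
      simp only [Set.mem_ofPred_eq] at hz ⊢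
      linarith
  have hfst : Q.fst.real (badContext a b qlo qup β)
      = Q.real (Prod.fst ⁻¹' badContext a b qlo qup β) := by
    rw [measureReal_def, measureReal_def,
      Measure.fst_apply (measurableSet_badContext ha hb hlo hup β)]
  rw [hfst]
  exact (measureReal_mono hsub).trans (measureReal_union_le _ _)

lemma badContext_comm {𝒮 : Type*} (a b qlo qup : 𝒮 → ℝ) (β : ℝ) :
    badContext a b qlo qup β = badContext qlo qup a b β := by
  ext s
  simp only [badContext, Set.mem_union, Set.mem_ofPred_eq, abs_sub_comm]

/-- The margin 3θ is spent in three equal parts: one on contexts where the fit is poor, one on the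
deviation of i from pm, and one is left as the deviation of the counts that Chebyshev controls.
Passing from oracle to fitted scores costs a shift β, hence the threshold window 2β. -/
lemma pi_badCalibration_le {𝒮 : Type*} [MeasurableSpace 𝒮] {Q : Measure (𝒮 × ℝ)}
    [IsProbabilityMeasure Q] {a b qlo qup : 𝒮 → ℝ} (ha : Measurable a) (hb : Measurable b)
    (hlo : Measurable qlo) (hup : Measurable qup) {β θ p : ℝ} (hθ : 0 < θ)
    (hbad : Q.fst.real (badContext a b qlo qup β) ≤ θ)
    (h1 : Q.real {z | score qlo qup z ≤ -β} ≤ p - 3 * θ)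
    (h2 : p + 3 * θ ≤ Q.real {z | score qlo qup z ≤ β})
    {m i : ℕ} (hm : m ≠ 0) (hi1 : (p - θ) * m ≤ i) (hi2 : (i : ℝ) ≤ (p + θ) * m) :
    (Measure.pi fun _ : Fin m => Q) (badCalibration a b (2 * β) m i)
      ≤ ENNReal.ofReal (2 / (m * θ ^ 2)) := by
  classical
  have hm0 : (0 : ℝ) < m := by positivity
  have hsc := measurable_score ha hb
  have g1 : Q.real {z | score a b z ≤ -(2 * β)} ≤ p - 2 * θ := by
    have := measureReal_score_le_le (Q := Q) ha hb hlo hup (β := β) (-(2 * β))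
    rw [show -(2 * β) + β = -β by ring] at this
    linarith
  have g2 : p + 2 * θ ≤ Q.real {z | score a b z ≤ 2 * β} := by
    have := measureReal_score_le_le (Q := Q) hlo hup ha hb (β := β) β
    rw [show β + β = 2 * β by ring, badContext_comm] at this
    linarith
  have d1 := pi_abs_card_sub_ge_le Q (hsc measurableSet_Iic : MeasurableSet
    {z | score a b z ≤ -(2 * β)}) hm hθ
  have d2 := pi_abs_card_sub_ge_le Q (hsc measurableSet_Iic : MeasurableSet
    {z | score a b z ≤ 2 * β}) hm hθ
  have hsub : badCalibration a b (2 * β) m i ⊆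
      {x | θ * m ≤ |((Finset.univ.filter fun j => x j ∈ {z | score a b z ≤ -(2 * β)}).card : ℝ)
        - m * Q.real {z | score a b z ≤ -(2 * β)}|} ∪
      {x | θ * m ≤ |((Finset.univ.filter fun j => x j ∈ {z | score a b z ≤ 2 * β}).card : ℝ)
        - m * Q.real {z | score a b z ≤ 2 * β}|} := by
    rintro c (hc | hc)
    · refine Or.inl ?_
      have hc' : (i : ℝ) ≤ ((Finset.univ.filter fun j => score a b (c j) ≤ -(2 * β)).card : ℝ) := by
        exact_mod_cast hc
      simp only [Set.mem_ofPred_eq]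
      refine le_trans ?_ (le_abs_self _)
      nlinarith
    · refine Or.inr ?_
      have hc' : ((Finset.univ.filter fun j => score a b (c j) ≤ 2 * β).card : ℝ) ≤ i := by
        exact_mod_cast hc.le
      simp only [Set.mem_ofPred_eq]
      refine le_trans ?_ (neg_le_abs _)
      nlinarith
  refine (measure_mono hsub).trans ((measure_union_le _ _).trans ((add_le_add d1 d2).trans_eq ?_))
  rw [← ENNReal.ofReal_add (by positivity) (by positivity)]
  congr 1
  ring

/-! ### The calibrated interval from training and calibration samples of fixed sizes -/

lemma prod_le_compl_add_of_slice_le {α β : Type*} [MeasurableSpace α] [MeasurableSpace β]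
    {μ : Measure α} [IsProbabilityMeasure μ] {ν : Measure β} [IsProbabilityMeasure ν]
    {E : Set (α × β)} (hE : MeasurableSet E) {G : Set α} (hG : MeasurableSet G) {r : ℝ≥0∞}
    (h : ∀ a ∈ G, ν (Prod.mk a ⁻¹' E) ≤ r) : (μ.prod ν) E ≤ μ Gᶜ + r := by
  rw [Measure.prod_apply hE]
  calc ∫⁻ a, ν (Prod.mk a ⁻¹' E) ∂μ ≤ ∫⁻ a, (Gᶜ.indicator (fun _ => 1) a + r) ∂μ := by
        refine lintegral_mono fun a => ?_
        by_cases ha : a ∈ G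
        · exact (h a ha).trans le_add_self
        · simp only [Set.indicator_of_mem (Set.mem_compl ha)]
          exact prob_le_one.trans le_self_add
    _ = μ Gᶜ + r := by
        rw [lintegral_add_right _ measurable_const]
        simp [lintegral_indicator hG.compl]

lemma measurableSet_badCalibration {𝒮 τ : Type*} [MeasurableSpace 𝒮] [MeasurableSpace τ]
    {a b : τ → 𝒮 → ℝ} (ha : Measurable (Function.uncurry a)) (hb : Measurable (Function.uncurry b))
    (β : ℝ) (m i : ℕ) :
    MeasurableSet {x : τ × (Fin m → 𝒮 × ℝ) | x.2 ∈ badCalibration (a x.1) (b x.1) β m i} := by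
  classical
  have hsc : ∀ j : Fin m, Measurable fun x : τ × (Fin m → 𝒮 × ℝ) =>
      score (a x.1) (b x.1) (x.2 j) := fun j => by
    have h1 : Measurable fun x : τ × (Fin m → 𝒮 × ℝ) => (x.1, (x.2 j).1) := by fun_prop
    have h2 : Measurable fun x : τ × (Fin m → 𝒮 × ℝ) => (x.2 j).2 := by fun_prop
    exact ((ha.comp h1).sub h2).max (h2.sub (hb.comp h1))
  have hc : ∀ y : ℝ, Measurable fun x : τ × (Fin m → 𝒮 × ℝ) =>
      ((Finset.univ.filter fun j => score (a x.1) (b x.1) (x.2 j) ≤ y).card : ℝ) := fun y =>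
    measurable_card_filter (fun j : Fin m => {x : τ × (Fin m → 𝒮 × ℝ) |
      score (a x.1) (b x.1) (x.2 j) ≤ y}) fun j => measurableSet_le (hsc j) measurable_const
  have heq : {x : τ × (Fin m → 𝒮 × ℝ) | x.2 ∈ badCalibration (a x.1) (b x.1) β m i} =
      {x | (i : ℝ) ≤ ((Finset.univ.filter fun j =>
          score (a x.1) (b x.1) (x.2 j) ≤ -β).card : ℝ)} ∪
      {x | ((Finset.univ.filter fun j =>
          score (a x.1) (b x.1) (x.2 j) ≤ β).card : ℝ) < i} := by
    ext x
    simp only [badCalibration, Set.mem_ofPred_eq, Set.mem_union, Nat.cast_le, Nat.cast_lt]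
  rw [heq]
  exact (measurableSet_le measurable_const (hc _)).union (measurableSet_lt (hc _) measurable_const)

lemma measurableSet_badContext_uncurry {𝒮 τ : Type*} [MeasurableSpace 𝒮] [MeasurableSpace τ]
    {a b : τ → 𝒮 → ℝ} (ha : Measurable (Function.uncurry a)) (hb : Measurable (Function.uncurry b))
    {qlo qup : 𝒮 → ℝ} (hlo : Measurable qlo) (hup : Measurable qup) (β : ℝ) :
    MeasurableSet {x : τ × 𝒮 | x.2 ∈ badContext (a x.1) (b x.1) qlo qup β} := by
  have h1 : Measurable fun x : τ × 𝒮 => |a x.1 x.2 - qlo x.2| :=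
    (ha.sub (hlo.comp measurable_snd)).abs
  have h2 : Measurable fun x : τ × 𝒮 => |b x.1 x.2 - qup x.2| :=
    (hb.sub (hup.comp measurable_snd)).abs
  exact (measurableSet_le measurable_const h1).union (measurableSet_le measurable_const h2)

lemma volume_symmDiff_pacCP_lt {𝒮 : Type*} {a b qlo qup : 𝒮 → ℝ} {ε δ β : ℝ} (hβ : 0 < β)
    (hδ : 0 < δ) {m : ℕ} {c : Fin m → 𝒮 × ℝ} {s : 𝒮}
    (hc : c ∉ badCalibration a b (2 * β) m ((m : ℤ) - kIndex m ε δ).toNat)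
    (hs : s ∉ badContext a b qlo qup β) :
    volume (symmDiff (pacCP ε δ a b c s) (Set.Icc (qlo s) (qup s))) < ENNReal.ofReal (6 * β) := by
  have hk := (isGreatest_kIndex m (ε := ε) hδ).1
  obtain ⟨τ, hτ, hτβ⟩ := exists_orderStat_of_notMem_badCalibration
    (by have := hk.2.1; omega) hc
  have hpac : pacCP ε δ a b c s = Set.Icc (a s - τ) (b s + τ) := by
    rw [pacCP, pacThreshold, hτ, predInterval_coe]
  simp only [badContext, Set.mem_union, Set.mem_ofPred_eq, not_or, not_le] at hs
  rw [hpac]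
  refine (volume_symmDiff_Icc_le _ _ _ _).trans_lt ?_
  refine (ENNReal.ofReal_lt_ofReal_iff (by positivity)).2 ?_
  have h1 : |a s - τ - qlo s| ≤ |a s - qlo s| + |τ| := by
    rw [show a s - τ - qlo s = (a s - qlo s) - τ by ring]
    exact abs_sub _ _
  have h2 : |b s + τ - qup s| ≤ |b s - qup s| + |τ| := by
    rw [show b s + τ - qup s = (b s - qup s) + τ by ring]
    exact abs_add_le _ _
  linarith [hs.1, hs.2]

theorem exists_forall_prod_pacCP_le {𝒮 : Type*} [MeasurableSpace 𝒮] {PS : Measure 𝒮}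
    [IsProbabilityMeasure PS] {κ : Kernel 𝒮 ℝ} [IsMarkovKernel κ] {ε δ εlo εup : ℝ}
    (hε : ε ∈ Set.Ioo (0 : ℝ) 1) (hδ : δ ∈ Set.Ioo (0 : ℝ) 1) (hlevels : εup - εlo = 1 - ε)
    {qlo qup : 𝒮 → ℝ} (hqlo : IsConditionalQuantile PS κ εlo qlo)
    (hqup : IsConditionalQuantile PS κ εup qup)
    {qloHat qupHat : (l : ℕ) → (Fin l → 𝒮 × ℝ) → 𝒮 → ℝ}
    (hqloHat : ∀ l, Measurable (Function.uncurry (qloHat l)))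
    (hqupHat : ∀ l, Measurable (Function.uncurry (qupHat l)))
    (hcons : QuantileConsistency PS (PS ⊗ₘ κ) qloHat qupHat qlo qup)
    (hreg : DensityPositiveNearZero ((PS ⊗ₘ κ).map (score qlo qup)))
    {η r : ℝ} (hη : 0 < η) (hr : 0 < r) :
    ∃ L : ℕ, ∀ l ≥ L, ∀ m ≥ L,
      ((Measure.pi fun _ : Fin l => PS ⊗ₘ κ).prod
        ((Measure.pi fun _ : Fin m => PS ⊗ₘ κ).prod PS))
        {x | ENNReal.ofReal η ≤ volume (symmDiff
          (pacCP ε δ (qloHat l x.1) (qupHat l x.1) x.2.1 x.2.2)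
          (Set.Icc (qlo x.2.2) (qup x.2.2)))} ≤ ENNReal.ofReal r := by
  set Q := PS ⊗ₘ κ with hQ
  have hT := measurable_score hqlo.1 hqup.1
  have : IsProbabilityMeasure (Q.map (score qlo qup)) := Measure.isProbabilityMeasure_map
    hT.aemeasurable
  have hF0 : Q.real {z | score qlo qup z ≤ 0} = 1 - ε := by
    rw [← hlevels]
    refine compProd_score_le_zero hqlo hqup (by linarith [hε.2]) ?_
    have := hreg.measure_singleton 0
    rwa [Measure.map_apply hT (measurableSet_singleton 0)] at this
  obtain ⟨c, hc, b, hb, hcb⟩ := hreg.exists_Ioc_ge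
  have hIoc : ∀ x y : ℝ, -b < x → x ≤ y → y < b →
      Q.real {z | score qlo qup z ≤ x} + c * (y - x) ≤ Q.real {z | score qlo qup z ≤ y} := by
    intro x y hx hxy hy
    have h1 := hcb x y hx hxy hy
    rw [map_measureReal_apply hT measurableSet_Ioc] at h1
    have h2 := measureReal_union (μ := Q) (s₁ := {z | score qlo qup z ≤ x})
      (s₂ := score qlo qup ⁻¹' Set.Ioc x y)
      (Set.disjoint_left.2 fun z hz hz' => not_lt.2 (Set.mem_ofPred.1 hz) hz'.1)
      (hT measurableSet_Ioc)
    have h3 : Q.real ({z | score qlo qup z ≤ x} ∪ score qlo qup ⁻¹' Set.Ioc x y)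
        ≤ Q.real {z | score qlo qup z ≤ y} :=
      measureReal_mono (Set.union_subset (fun z hz => (Set.mem_ofPred.1 hz).trans hxy)
        fun z hz => hz.2)
    linarith
  -- β stays inside the window of the density bound, and the final error 6β stays below η. With θ =
  -- cβ/3, the mass gained over a length β is exactly the margin 3θ.
  set β := min (b / 2) (η / 6) with hβdef
  have hβ : 0 < β := by positivity
  have hβb : β < b := (min_le_left _ _).trans_lt (half_lt_self hb)
  have hβη : 6 * β ≤ η := by linarith [min_le_right (b / 2) (η / 6)]
  set θ := c * β / 3 with hθdef
  have hθ : 0 < θ := by positivity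
  have h1 : Q.real {z | score qlo qup z ≤ -β} ≤ (1 - ε) - 3 * θ := by
    have := hIoc (-β) 0 (by linarith) (by linarith) hb
    rw [hθdef]; linarith
  have h2 : (1 - ε) + 3 * θ ≤ Q.real {z | score qlo qup z ≤ β} := by
    have := hIoc 0 β (by linarith) hβ.le hβb
    rw [hθdef]; linarith
  obtain ⟨e, ρ, he, hρ, hcons⟩ := hcons
  -- By Markov, each fitted function is off by β on contexts of mass at most e/(2β²). The sum over
  -- both must be at most θ, for the comparison of scores, and at most r/4, for the test context.
  have hemin : 0 < β ^ 2 * min θ (r / 4) := by positivity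
  have hev1 : ∀ᶠ l in atTop, e l < β ^ 2 * min θ (r / 4) := he.eventually_lt_const hemin
  have hev2 : ∀ᶠ l in atTop, ρ l < r / 2 := hρ.eventually_lt_const (by positivity)
  obtain ⟨L₁, hL₁⟩ := eventually_atTop.1 (hev1.and (hev2.and hcons))
  -- Makes the calibration failure 2/(mθ²) at most r/4. The budget r is split into four: two
  -- training failures, the calibration, and the test context.
  have hev3 : ∀ᶠ m : ℕ in atTop, 8 / (r * θ ^ 2) ≤ m := by
    filter_upwards [eventually_ge_atTop ⌈8 / (r * θ ^ 2)⌉₊] with m hm using Nat.ceil_le.1 hm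
  obtain ⟨L₂, hL₂⟩ := eventually_atTop.1
    (hev3.and ((eventually_kIndex_bounds hε hδ hθ).and (eventually_ne_atTop 0)))
  refine ⟨max L₁ L₂, fun l hl m hm => ?_⟩
  obtain ⟨hel, hρl, hcl1, hcl2⟩ := hL₁ l (le_of_max_le_left hl)
  obtain ⟨hmr, ⟨hk1, hk2⟩, hm0⟩ := hL₂ m (le_of_max_le_right hm)
  have hmpos : (0 : ℝ) < m := by positivity
  set i := ((m : ℤ) - kIndex m ε δ).toNat with hi
  have hicast : (i : ℝ) = m - kIndex m ε δ := by
    have hk := (isGreatest_kIndex m (ε := ε) hδ.1).1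
    have : ((i : ℕ) : ℤ) = (m : ℤ) - kIndex m ε δ := Int.toNat_of_nonneg (by linarith [hk.2.1])
    exact_mod_cast congrArg (Int.cast : ℤ → ℝ) this
  set G₁ : Set (Fin l → 𝒮 × ℝ) :=
    {t | ∫⁻ s, ENNReal.ofReal ((qloHat l t s - qlo s) ^ 2) ∂PS ≤ ENNReal.ofReal (e l / 2)}
  set G₂ : Set (Fin l → 𝒮 × ℝ) :=
    {t | ∫⁻ s, ENNReal.ofReal ((qupHat l t s - qup s) ^ 2) ∂PS ≤ ENNReal.ofReal (e l / 2)}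
  have hG : ∀ (q : (Fin l → 𝒮 × ℝ) → 𝒮 → ℝ) (q' : 𝒮 → ℝ), Measurable (Function.uncurry q) →
      Measurable q' → MeasurableSet {t | ∫⁻ s, ENNReal.ofReal ((q t s - q' s) ^ 2) ∂PS
        ≤ ENNReal.ofReal (e l / 2)} := fun q q' hq hq' => by
    have : Measurable (Function.uncurry fun t s => ENNReal.ofReal ((q t s - q' s) ^ 2)) :=
      ((hq.sub (hq'.comp measurable_snd)).pow_const 2).ennreal_ofReal
    exact measurableSet_le this.lintegral_prod_right' measurable_const
  have hG₁ : MeasurableSet G₁ := hG _ _ (hqloHat l) hqlo.1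
  have hG₂ : MeasurableSet G₂ := hG _ _ (hqupHat l) hqup.1
  have hcompl : ∀ G : Set (Fin l → 𝒮 × ℝ), MeasurableSet G →
      1 - ρ l / 2 ≤ (Measure.pi fun _ : Fin l => Q).real G →
      (Measure.pi fun _ : Fin l => Q) Gᶜ ≤ ENNReal.ofReal (r / 4) := fun G hGm hle => by
    refine (ENNReal.le_ofReal_iff_toReal_le (measure_ne_top _ _) (by positivity)).2 ?_
    rw [← measureReal_def, probReal_compl_eq_one_sub hGm]
    linarith
  -- A measurable superset of the event in question, so that Fubini applies without measurability of
  -- the symmetric difference's volume.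
  set E : Set ((Fin l → 𝒮 × ℝ) × (Fin m → 𝒮 × ℝ) × 𝒮) :=
    {x | x.2.1 ∈ badCalibration (qloHat l x.1) (qupHat l x.1) (2 * β) m i} ∪
      {x | x.2.2 ∈ badContext (qloHat l x.1) (qupHat l x.1) qlo qup β} with hEdef
  have hE : MeasurableSet E := by
    have m1 : Measurable fun x : (Fin l → 𝒮 × ℝ) × (Fin m → 𝒮 × ℝ) × 𝒮 => (x.1, x.2.1) := by
      fun_prop
    have m2 : Measurable fun x : (Fin l → 𝒮 × ℝ) × (Fin m → 𝒮 × ℝ) × 𝒮 => (x.1, x.2.2) := by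
      fun_prop
    exact (m1 (measurableSet_badCalibration (hqloHat l) (hqupHat l) (2 * β) m i)).union
      (m2 (measurableSet_badContext_uncurry (hqloHat l) (hqupHat l) hqlo.1 hqup.1 β))
  have hslice : ∀ t ∈ G₁ ∩ G₂, ((Measure.pi fun _ : Fin m => Q).prod PS) (Prod.mk t ⁻¹' E)
      ≤ ENNReal.ofReal (r / 4) + ENNReal.ofReal (r / 4) := by
    intro t ht
    have ha : Measurable (qloHat l t) := (hqloHat l).of_uncurry_left
    have hb : Measurable (qupHat l t) := (hqupHat l).of_uncurry_left
    have hctx : PS (badContext (qloHat l t) (qupHat l t) qlo qup β)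
        ≤ ENNReal.ofReal (min θ (r / 4)) := by
      refine (measure_union_le _ _).trans ((add_le_add
        (measure_abs_sub_ge_le ha hqlo.1 hβ ht.1) (measure_abs_sub_ge_le hb hqup.1 hβ ht.2)).trans ?_)
      have hhalf : e l / 2 / β ^ 2 ≤ min θ (r / 4) / 2 := by
        rw [div_le_iff₀ (by positivity)]
        linarith
      refine (add_le_add (ENNReal.ofReal_le_ofReal hhalf) (ENNReal.ofReal_le_ofReal hhalf)).trans ?_
      rw [← ENNReal.ofReal_add (by positivity) (by positivity), add_halves]
    have hsub : Prod.mk t ⁻¹' E ⊆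
        (badCalibration (qloHat l t) (qupHat l t) (2 * β) m i ×ˢ Set.univ) ∪
        (Set.univ ×ˢ badContext (qloHat l t) (qupHat l t) qlo qup β) := by
      rintro ⟨c, s⟩ (h | h)
      · exact Or.inl ⟨h, Set.mem_univ _⟩
      · exact Or.inr ⟨Set.mem_univ _, h⟩
    refine (measure_mono hsub).trans ((measure_union_le _ _).trans ?_)
    rw [Measure.prod_prod, Measure.prod_prod, measure_univ, measure_univ, mul_one, one_mul]
    refine add_le_add ?_ (hctx.trans (ENNReal.ofReal_le_ofReal (min_le_right _ _)))
    have hfst : Q.fst.real (badContext (qloHat l t) (qupHat l t) qlo qup β) ≤ θ := by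
      rw [hQ, Measure.fst_compProd]
      exact ENNReal.toReal_le_of_le_ofReal hθ.le
        (hctx.trans (ENNReal.ofReal_le_ofReal (min_le_left _ _)))
    refine (pi_badCalibration_le ha hb hqlo.1 hqup.1 hθ hfst h1 h2 hm0 ?_ ?_).trans
      (ENNReal.ofReal_le_ofReal ?_)
    · rw [hicast]; linarith
    · rw [hicast]; linarith
    · rw [div_le_iff₀ (by positivity)] at hmr ⊢
      linarith
  have hbadE : {x : (Fin l → 𝒮 × ℝ) × (Fin m → 𝒮 × ℝ) × 𝒮 | ENNReal.ofReal η ≤ volume (symmDiff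
      (pacCP ε δ (qloHat l x.1) (qupHat l x.1) x.2.1 x.2.2)
      (Set.Icc (qlo x.2.2) (qup x.2.2)))} ⊆ E := by
    intro x hx
    by_contra hxE
    simp only [hEdef, Set.mem_union, Set.mem_ofPred_eq, not_or] at hxE
    have := volume_symmDiff_pacCP_lt hβ hδ.1 hxE.1 hxE.2
    exact absurd (this.trans_le (ENNReal.ofReal_le_ofReal hβη)) (not_lt.2 (Set.mem_ofPred.1 hx))
  refine (measure_mono hbadE).trans
    ((prod_le_compl_add_of_slice_le hE (hG₁.inter hG₂) hslice).trans ?_)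
  have hGc : (Measure.pi fun _ : Fin l => Q) (G₁ ∩ G₂)ᶜ
      ≤ ENNReal.ofReal (r / 4) + ENNReal.ofReal (r / 4) := by
    rw [Set.compl_inter]
    exact (measure_union_le _ _).trans (add_le_add (hcompl _ hG₁ hcl1) (hcompl _ hG₂ hcl2))
  refine (add_le_add_left hGc _).trans ?_
  rw [← ENNReal.ofReal_add (by positivity) (by positivity),
    ← ENNReal.ofReal_add (by positivity) (by positivity)]
  exact ENNReal.ofReal_le_ofReal (by linarith)

/-! ### Rejection sampling turns the behavior policy into the target policy -/

section Policy

variable {𝒮 𝒜 : Type*} {pb pe : 𝒮 → 𝒜 → ℝ≥0}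

/-- The set of bounds is closed, so its infimum is attained. -/
lemma ratioBound_mem (hB : (ratioBounds pb pe).Nonempty) :
    ratioBound pb pe ∈ ratioBounds pb pe := by
  have hclosed : IsClosed (ratioBounds pb pe) := by
    have : ratioBounds pb pe = ⋂ s, ⋂ a, {b : ℝ≥0 | pe s a ≤ b * pb s a} := by
      ext b; simp [ratioBounds]
    rw [this]
    exact isClosed_iInter fun s => isClosed_iInter fun a =>
      isClosed_le continuous_const (by fun_prop)
  exact hclosed.csInf_mem hB (OrderBot.bddBelow _)

/-- Where π_b vanishes so does π_e, by the ratio bound; hence the convention 0/0 = 0 loses no mass.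
-/
lemma density_mul_acceptProb (hB : (ratioBounds pb pe).Nonempty) (s : 𝒮) (a : 𝒜) :
    pb s a * (1 / ratioBound pb pe * weight pb pe s a) = 1 / ratioBound pb pe * pe s a := by
  rcases eq_or_ne (pb s a) 0 with h | h
  · have := ratioBound_mem hB s a
    rw [h, mul_zero] at this
    simp [h, le_antisymm this zero_le]
  · rw [weight]
    field_simp

/-- The region of the space of observations and uniform variables where the rejection step keeps
the observation. -/
def acceptRegion (pb pe : 𝒮 → 𝒜 → ℝ≥0) : Set ((𝒮 × 𝒜 × ℝ) × ℝ) :=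
  {y | y.2 ≤ ((1 / ratioBound pb pe * weight pb pe y.1.1 y.1.2.1 : ℝ≥0) : ℝ)}

lemma restrict_Icc_setOf_le {c : ℝ≥0} (hc : c ≤ 1) :
    (volume.restrict (Set.Icc (0 : ℝ) 1)) {v | v ≤ (c : ℝ)} = c := by
  rw [Measure.restrict_apply (measurableSet_le measurable_id' measurable_const)]
  have hc' : (c : ℝ) ≤ 1 := by exact_mod_cast hc
  have : {v : ℝ | v ≤ (c : ℝ)} ∩ Set.Icc 0 1 = Set.Icc 0 (c : ℝ) := by
    ext v
    simp only [Set.mem_inter_iff, Set.mem_ofPred_eq, Set.mem_Icc]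
    constructor
    · exact fun h => ⟨h.2.1, h.1⟩
    · exact fun h => ⟨h.2, h.1, h.2.trans hc'⟩
  rw [this, Real.volume_Icc, sub_zero, ENNReal.ofReal_coe_nnreal]

variable [MeasurableSpace 𝒮] [MeasurableSpace 𝒜] {ν : Kernel 𝒮 𝒜} {p : 𝒮 → 𝒜 → ℝ≥0}

lemma IsPolicyDensity.measurable_coe (hp : IsPolicyDensity ν p) :
    Measurable (Function.uncurry fun s a => (p s a : ℝ≥0∞)) :=
  measurable_coe_nnreal_ennreal.comp hp.measurable

lemma measurable_acceptProb (hpb : IsPolicyDensity ν pb) (hpe : IsPolicyDensity ν pe) :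
    Measurable fun x : 𝒮 × 𝒜 => 1 / ratioBound pb pe * weight pb pe x.1 x.2 :=
  measurable_const.mul (hpe.measurable.div hpb.measurable)

lemma measurableSet_acceptRegion (hpb : IsPolicyDensity ν pb) (hpe : IsPolicyDensity ν pe) :
    MeasurableSet (acceptRegion pb pe) := by
  have h : Measurable fun y : (𝒮 × 𝒜 × ℝ) × ℝ => (y.1.1, y.1.2.1) := by fun_prop
  exact measurableSet_le measurable_snd
    (measurable_coe_nnreal_real.comp ((measurable_acceptProb hpb hpe).comp h))

/-- Integrate π_e ≤ B π_b over the actions at any one context. -/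
lemma one_le_ratioBound [Nonempty 𝒮] (hpb : IsPolicyDensity ν pb) (hpe : IsPolicyDensity ν pe)
    (hB : (ratioBounds pb pe).Nonempty) : 1 ≤ ratioBound pb pe := by
  obtain ⟨s⟩ := ‹Nonempty 𝒮›
  have hmem := ratioBound_mem hB
  have : (1 : ℝ≥0∞) ≤ ratioBound pb pe := by
    calc (1 : ℝ≥0∞) = ∫⁻ a, pe s a ∂(ν s) := (hpe.lintegral_eq_one s).symm
      _ ≤ ∫⁻ a, ratioBound pb pe * pb s a ∂(ν s) :=
        lintegral_mono fun a => by
          rw [← ENNReal.coe_mul]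
          exact ENNReal.coe_le_coe.2 (hmem s a)
      _ = ratioBound pb pe := by
        rw [lintegral_const_mul _ hpb.measurable_coe.of_uncurry_left, hpb.lintegral_eq_one s,
          mul_one]
  exact_mod_cast this

lemma acceptProb_le_one [Nonempty 𝒮] (hpb : IsPolicyDensity ν pb) (hpe : IsPolicyDensity ν pe)
    (hB : (ratioBounds pb pe).Nonempty) (s : 𝒮) (a : 𝒜) :
    1 / ratioBound pb pe * weight pb pe s a ≤ 1 := by
  have h0 : 0 < ratioBound pb pe := zero_lt_one.trans_le (one_le_ratioBound hpb hpe hB)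
  rw [one_div, inv_mul_le_iff₀ h0, mul_one, weight]
  rcases eq_or_ne (pb s a) 0 with h | h
  · simp [h]
  · rw [div_le_iff₀ (pos_iff_ne_zero.2 h)]
    exact ratioBound_mem hB s a

variable [IsSFiniteKernel ν]

lemma IsPolicyDensity.isMarkovKernel (hp : IsPolicyDensity ν p) : IsMarkovKernel (policy ν p) :=
  ⟨fun s => ⟨by
    rw [policy, Kernel.withDensity_apply' _ hp.measurable_coe, setLIntegral_univ,
      hp.lintegral_eq_one]⟩⟩

lemma IsPolicyDensity.lintegral_policy (hp : IsPolicyDensity ν p) (s : 𝒮) {g : 𝒜 → ℝ≥0∞}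
    (hg : Measurable g) : ∫⁻ a, g a ∂(policy ν p s) = ∫⁻ a, p s a * g a ∂(ν s) :=
  Kernel.lintegral_withDensity _ hp.measurable_coe _ hg

variable (PS : Measure 𝒮) [IsProbabilityMeasure PS] (PR : Kernel (𝒮 × 𝒜) ℝ) [IsMarkovKernel PR]

lemma contextRewardLaw_apply (hpe : IsPolicyDensity ν pe) {E : Set (𝒮 × ℝ)}
    (hE : MeasurableSet E) :
    contextRewardLaw PS (policy ν pe) PR E
      = ∫⁻ s, ∫⁻ a, pe s a * PR (s, a) (Prod.mk s ⁻¹' E) ∂(ν s) ∂PS := by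
  have := hpe.isMarkovKernel
  rw [contextRewardLaw, rewardKernel, Measure.compProd_apply hE]
  refine lintegral_congr fun s => ?_
  have hEs : MeasurableSet (Prod.mk s ⁻¹' E) := measurable_prodMk_left hE
  rw [Kernel.snd_apply' _ _ hEs, Kernel.compProd_apply (measurable_snd hEs)]
  exact hpe.lintegral_policy s ((Kernel.measurable_coe PR hEs).comp measurable_prodMk_left)

/-- Integrating out the uniform variable leaves the factor w/B, and π_b · w/B = π_e/B. With E the
whole space, the acceptance probability is 1/B. -/
theorem measure_acceptRegion_inter [Nonempty 𝒮] (hpb : IsPolicyDensity ν pb)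
    (hpe : IsPolicyDensity ν pe) (hB : (ratioBounds pb pe).Nonempty) {E : Set (𝒮 × ℝ)}
    (hE : MeasurableSet E) :
    ((observationLaw PS (policy ν pb) PR).prod (volume.restrict (Set.Icc (0 : ℝ) 1)))
      (acceptRegion pb pe ∩ (fun y => (y.1.1, y.1.2.2)) ⁻¹' E)
      = (1 / ratioBound pb pe : ℝ≥0) * contextRewardLaw PS (policy ν pe) PR E := by
  have := hpb.isMarkovKernel
  have hacc := measurable_acceptProb hpb hpe
  have hproj : Measurable fun y : (𝒮 × 𝒜 × ℝ) × ℝ => (y.1.1, y.1.2.2) := by fun_prop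
  have hproj' : Measurable fun d : 𝒮 × 𝒜 × ℝ => (d.1, d.2.2) := by fun_prop
  have hsa : Measurable fun d : 𝒮 × 𝒜 × ℝ => (d.1, d.2.1) := by fun_prop
  set f : 𝒮 × 𝒜 × ℝ → ℝ≥0∞ := fun d =>
    ((1 / ratioBound pb pe * weight pb pe d.1 d.2.1 : ℝ≥0) : ℝ≥0∞) *
      E.indicator (fun _ => 1) (d.1, d.2.2) with hf
  have hfm : Measurable f := (measurable_coe_nnreal_ennreal.comp (hacc.comp hsa)).mul
    ((measurable_const.indicator hE).comp hproj')
  rw [Measure.prod_apply ((measurableSet_acceptRegion hpb hpe).inter (hproj hE))]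
  have hslice : ∀ d : 𝒮 × 𝒜 × ℝ, (volume.restrict (Set.Icc (0 : ℝ) 1))
      (Prod.mk d ⁻¹' (acceptRegion pb pe ∩ (fun y => (y.1.1, y.1.2.2)) ⁻¹' E)) = f d := by
    intro d
    by_cases hd : (d.1, d.2.2) ∈ E
    · have : Prod.mk d ⁻¹' (acceptRegion pb pe ∩ (fun y => (y.1.1, y.1.2.2)) ⁻¹' E)
          = {v : ℝ | v ≤ ((1 / ratioBound pb pe * weight pb pe d.1 d.2.1 : ℝ≥0) : ℝ)} := by
        ext v; simp [acceptRegion, hd]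
      rw [this, restrict_Icc_setOf_le (acceptProb_le_one hpb hpe hB _ _), hf]
      simp [hd]
    · have : Prod.mk d ⁻¹' (acceptRegion pb pe ∩ (fun y => (y.1.1, y.1.2.2)) ⁻¹' E) = ∅ := by
        ext v; simp [hd]
      rw [this, hf]
      simp [hd]
  simp_rw [hslice]
  rw [observationLaw, Measure.lintegral_compProd hfm, contextRewardLaw_apply PS PR hpe hE]
  have hPRm : Measurable fun x : 𝒮 × 𝒜 => PR x (Prod.mk x.1 ⁻¹' E) := by
    have h : Measurable fun y : (𝒮 × 𝒜) × ℝ => (y.1.1, y.2) := by fun_prop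
    exact Kernel.measurable_kernel_prodMk_left (κ := PR) (h hE)
  have hpePR : Measurable fun x : 𝒮 × 𝒜 => (pe x.1 x.2 : ℝ≥0∞) * PR x (Prod.mk x.1 ⁻¹' E) :=
    hpe.measurable_coe.mul hPRm
  rw [← lintegral_const_mul _ hpePR.lintegral_kernel_prod_right']
  refine lintegral_congr fun s => ?_
  have hfs : Measurable fun b => f (s, b) := hfm.comp measurable_prodMk_left
  have hg : Measurable fun a => ((1 / ratioBound pb pe * weight pb pe s a : ℝ≥0) : ℝ≥0∞) *
      PR (s, a) (Prod.mk s ⁻¹' E) :=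
    (measurable_coe_nnreal_ennreal.comp (hacc.comp measurable_prodMk_left)).mul
      (hPRm.comp measurable_prodMk_left)
  have hg' : Measurable fun a => (pe s a : ℝ≥0∞) * PR (s, a) (Prod.mk s ⁻¹' E) :=
    hpePR.comp measurable_prodMk_left
  have hinner : ∀ a, ∫⁻ r, f (s, a, r) ∂(PR (s, a))
      = ((1 / ratioBound pb pe * weight pb pe s a : ℝ≥0) : ℝ≥0∞) * PR (s, a) (Prod.mk s ⁻¹' E) := by
    intro a
    have hEs : MeasurableSet (Prod.mk s ⁻¹' E) := measurable_prodMk_left hE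
    simp only [hf]
    rw [lintegral_const_mul' _ _ ENNReal.coe_ne_top]
    congr 1
    exact lintegral_indicator_one hEs
  rw [Kernel.lintegral_compProd _ _ _ hfs, lintegral_congr hinner, hpb.lintegral_policy s hg]
  simp only
  rw [← lintegral_const_mul _ hg']
  refine lintegral_congr fun a => ?_
  rw [← mul_assoc, ← mul_assoc, ← ENNReal.coe_mul, ← ENNReal.coe_mul, density_mul_acceptProb hB]

end Policy

/-! ### Subsamples of an i.i.d. sample -/

section Subsample

variable {α β : Type*} [MeasurableSpace α] [MeasurableSpace β]

lemma measurable_subsample {N : ℕ} (J : Finset (Fin N)) :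
    Measurable fun z : Fin N → α => subsample z J :=
  measurable_pi_lambda _ fun _ => measurable_pi_apply _

lemma prod_orderEmbOfFin {M : Type*} [CommMonoid M] {n : ℕ} (I : Finset (Fin n)) (h : Fin n → M) :
    ∏ j : Fin I.card, h (I.orderEmbOfFin rfl j) = ∏ i ∈ I, h i := by
  conv_rhs => rw [← Finset.map_orderEmbOfFin_univ I rfl]
  rw [Finset.prod_map]
  rfl

/-- The entries of an i.i.d. sample which lie in a given region are again i.i.d., given the set of
their indices. -/
theorem pi_selected_inter_subsample {μ : Measure α} [IsProbabilityMeasure μ] {Q : Measure β}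
    [IsProbabilityMeasure Q] {A : Set α} {g : α → β} (hg : Measurable g)
    {p : ℝ≥0∞} (hp : ∀ E, MeasurableSet E → μ (A ∩ g ⁻¹' E) = p * Q E) {n : ℕ}
    (I : Finset (Fin n)) {E : Set (Fin I.card → β)} (hE : MeasurableSet E) :
    (Measure.pi fun _ : Fin n => μ)
      ({y | ∀ i, i ∈ I ↔ y i ∈ A} ∩ (fun y => subsample (fun i => g (y i)) I) ⁻¹' E)
      = (Measure.pi fun _ : Fin n => μ) {y | ∀ i, i ∈ I ↔ y i ∈ A}
        * (Measure.pi fun _ : Fin I.card => Q) E := by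
  set S : Set (Fin n → α) := {y | ∀ i, i ∈ I ↔ y i ∈ A} with hS
  set φ : (Fin n → α) → (Fin I.card → β) := fun y => subsample (fun i => g (y i)) I with hφdef
  have hφ : Measurable φ := (measurable_subsample I).comp
    (measurable_pi_lambda _ fun i => hg.comp (measurable_pi_apply i))
  -- Fixing the selected set makes the event a box, so its measure is a product over coordinates.
  have hbox : ∀ t : Fin n → Set β, (∀ i, MeasurableSet (t i)) →
      (Measure.pi fun _ : Fin n => μ) (S ∩ {y | ∀ i ∈ I, g (y i) ∈ t i})
        = (∏ i ∈ I, p * Q (t i)) * ∏ i ∈ Iᶜ, μ Aᶜ := by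
    intro t ht
    have heq : S ∩ {y | ∀ i ∈ I, g (y i) ∈ t i}
        = Set.univ.pi fun i => if i ∈ I then A ∩ g ⁻¹' t i else Aᶜ := by
      ext y
      simp only [hS, Set.mem_inter_iff, Set.mem_ofPred_eq, Set.mem_univ_pi, ← forall_and]
      refine forall_congr' fun i => ?_
      by_cases hi : i ∈ I <;> simp [hi]
    rw [heq, Measure.pi_pi, ← Finset.prod_mul_prod_compl I]
    congr 1
    · exact Finset.prod_congr rfl fun i hi => by rw [if_pos hi, hp _ (ht i)]
    · exact Finset.prod_congr rfl fun i hi => by rw [if_neg (Finset.mem_compl.1 hi)]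
  have hSval : (Measure.pi fun _ : Fin n => μ) S = (∏ _i ∈ I, p) * ∏ i ∈ Iᶜ, μ Aᶜ := by
    have := hbox (fun _ => Set.univ) fun _ => MeasurableSet.univ
    simpa using this
  have hrect : ∀ s : Fin I.card → Set β, (∀ j, MeasurableSet (s j)) →
      (Measure.pi fun _ : Fin n => μ) (S ∩ φ ⁻¹' Set.univ.pi s)
        = (Measure.pi fun _ : Fin n => μ) S * ∏ j, Q (s j) := by
    intro s hs
    -- The sides of the rectangle moved from ranks in I back to the original indices, with no
    -- constraint off I.
    set t : Fin n → Set β := fun i =>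
      if h : i ∈ I then s ((I.orderIsoOfFin rfl).symm ⟨i, h⟩) else Set.univ with htdef
    have hts : ∀ j, t (I.orderEmbOfFin rfl j) = s j := fun j => by
      rw [htdef]
      simp only [Finset.orderEmbOfFin_mem, dite_true]
      congr 1
      exact (I.orderIsoOfFin rfl).symm_apply_apply j
    have ht : ∀ i, MeasurableSet (t i) := fun i => by
      by_cases h : i ∈ I
      · simp only [htdef, h, dite_true]; exact hs _
      · simp [htdef, h]
    have hpre : φ ⁻¹' Set.univ.pi s = {y | ∀ i ∈ I, g (y i) ∈ t i} := by
      ext y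
      simp only [Set.mem_preimage, Set.mem_univ_pi, Set.mem_ofPred_eq, hφdef, subsample]
      constructor
      · intro h i hi
        have := h ((I.orderIsoOfFin rfl).symm ⟨i, hi⟩)
        rw [← hts] at this
        have he : I.orderEmbOfFin rfl ((I.orderIsoOfFin rfl).symm ⟨i, hi⟩) = i := by
          rw [← Finset.coe_orderIsoOfFin_apply, OrderIso.apply_symm_apply]
        rwa [he] at this
      · intro h j
        rw [← hts]
        exact h _ (Finset.orderEmbOfFin_mem _ _ _)
    rw [hpre, hbox t ht, hSval, Finset.prod_mul_distrib, ← prod_orderEmbOfFin I fun i => Q (t i)]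
    simp_rw [hts]
    ring
  rcases eq_or_ne ((Measure.pi fun _ : Fin n => μ) S) 0 with h0 | h0
  · rw [h0, zero_mul]
    exact measure_mono_null Set.inter_subset_left h0
  · have hfin : (Measure.pi fun _ : Fin n => μ) S ≠ ⊤ := measure_ne_top _ _
    -- The conditional law of the subsample agrees with the product measure on rectangles, hence
    -- everywhere.
    have hpi : (Measure.pi fun _ : Fin I.card => Q)
        = ((Measure.pi fun _ : Fin n => μ) S)⁻¹ •
          ((Measure.pi fun _ : Fin n => μ).restrict S).map φ := by
      refine Measure.pi_eq fun s hs => ?_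
      have hsm : MeasurableSet (Set.univ.pi s) := MeasurableSet.univ_pi hs
      rw [Measure.smul_apply, Measure.map_apply hφ hsm, Measure.restrict_apply (hφ hsm),
        Set.inter_comm, hrect s hs, smul_eq_mul, ← mul_assoc, ENNReal.inv_mul_cancel h0 hfin,
        one_mul]
    rw [hpi, Measure.smul_apply, Measure.map_apply hφ hE, Measure.restrict_apply (hφ hE),
      smul_eq_mul, ← mul_assoc, ENNReal.mul_inv_cancel h0 hfin, one_mul, Set.inter_comm]

/-- A part of an i.i.d. sample and the remaining part are independent i.i.d. samples. -/
theorem measurePreserving_subsample_prod_compl (Q : Measure α) [IsProbabilityMeasure Q] {N : ℕ}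
    (J : Finset (Fin N)) :
    MeasurePreserving (fun z : Fin N → α => (subsample z J, subsample z Jᶜ))
      (Measure.pi fun _ => Q)
      ((Measure.pi fun _ : Fin J.card => Q).prod (Measure.pi fun _ : Fin Jᶜ.card => Q)) := by
  let e : Fin J.card ⊕ Fin Jᶜ.card ≃ Fin N := finSumEquivOfFinset rfl rfl
  have h1 := (measurePreserving_piCongrLeft (fun _ : Fin N => Q) e).symm
  have h2 := measurePreserving_sumPiEquivProdPi fun _ : Fin J.card ⊕ Fin Jᶜ.card => Q
  convert h2.comp h1 using 1
  funext z
  refine Prod.ext (funext fun j => ?_) (funext fun j => ?_)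
  · exact congrArg z (finSumEquivOfFinset_inl rfl rfl j).symm
  · exact congrArg z (finSumEquivOfFinset_inr rfl rfl j).symm

end Subsample

/-! ### Random selection followed by a random split -/

section Selection

variable {α β X 𝒰 : Type*} [MeasurableSpace α] [MeasurableSpace β] [MeasurableSpace X]
  [MeasurableSpace 𝒰]

lemma measurableSet_selected {A : Set α} (hA : MeasurableSet A) {n : ℕ} (I : Finset (Fin n)) :
    MeasurableSet {y : Fin n → α | ∀ i, i ∈ I ↔ y i ∈ A} := by
  have : {y : Fin n → α | ∀ i, i ∈ I ↔ y i ∈ A}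
      = ⋂ i, {y : Fin n → α | i ∈ I ↔ y i ∈ A} := by
    ext y; simp
  rw [this]
  refine MeasurableSet.iInter fun i => ?_
  by_cases hi : i ∈ I
  · simp only [hi, true_iff]
    exact measurableSet_preimage (measurable_pi_apply i) hA
  · simp only [hi, false_iff]
    exact (measurableSet_preimage (measurable_pi_apply i) hA).compl

lemma prod_pi_selected {μ : Measure α} [IsProbabilityMeasure μ] {Q : Measure β}
    [IsProbabilityMeasure Q] {A : Set α} (hA : MeasurableSet A) {g : α → β} (hg : Measurable g)
    {p : ℝ≥0∞} (hp : ∀ E, MeasurableSet E → μ (A ∩ g ⁻¹' E) = p * Q E) (ν : Measure X)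
    [IsProbabilityMeasure ν] {n : ℕ} (I : Finset (Fin n)) {E : Set (X × (Fin I.card → β))}
    (hE : MeasurableSet E) :
    (ν.prod (Measure.pi fun _ : Fin n => μ))
      {w | (∀ i, i ∈ I ↔ w.2 i ∈ A) ∧ (w.1, subsample (fun i => g (w.2 i)) I) ∈ E}
      = (Measure.pi fun _ : Fin n => μ) {y | ∀ i, i ∈ I ↔ y i ∈ A}
        * (ν.prod (Measure.pi fun _ : Fin I.card => Q)) E := by
  have hφ : Measurable fun y : Fin n → α => subsample (fun i => g (y i)) I :=
    (measurable_subsample I).comp (measurable_pi_lambda _ fun i => hg.comp (measurable_pi_apply i))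
  have hm : MeasurableSet {w : X × (Fin n → α) | (∀ i, i ∈ I ↔ w.2 i ∈ A) ∧
      (w.1, subsample (fun i => g (w.2 i)) I) ∈ E} :=
    (measurable_snd (measurableSet_selected hA I)).inter
      ((measurable_fst.prodMk (hφ.comp measurable_snd)) hE)
  rw [Measure.prod_apply hm, Measure.prod_apply hE, ← lintegral_const_mul _
    (measurable_measure_prodMk_left hE)]
  exact lintegral_congr fun x => pi_selected_inter_subsample hg hp I (measurable_prodMk_left hE)

/-- If a set of triples of a training sample, a calibration sample and a context has small
probability for all large fixed sizes, then so it has when the two samples arise from a random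
selection and a random split. -/
theorem prod_selected_split_le {μ : Measure α} [IsProbabilityMeasure μ] {Q : Measure β}
    [IsProbabilityMeasure Q] {A : Set α} (hA : MeasurableSet A) {g : α → β} (hg : Measurable g)
    {p : ℝ≥0∞} (hp : ∀ E, MeasurableSet E → μ (A ∩ g ⁻¹' E) = p * Q E) (ν : Measure X)
    [IsProbabilityMeasure ν] (W : Measure 𝒰) [IsProbabilityMeasure W]
    {split : (N : ℕ) → 𝒰 → Finset (Fin N)}
    (hsplit : ∀ N J, MeasurableSet {u | split N u = J}) {K L : ℕ}
    (hK : ∀ N ≥ K, ∀ u, L ≤ (split N u).card ∧ L ≤ (split N u)ᶜ.card)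
    (B : (l m : ℕ) → Set ((Fin l → β) × (Fin m → β) × X)) {r : ℝ≥0∞}
    (hB : ∀ l ≥ L, ∀ m ≥ L, ((Measure.pi fun _ : Fin l => Q).prod
      ((Measure.pi fun _ : Fin m => Q).prod ν)) (B l m) ≤ r) (n : ℕ) :
    (W.prod (ν.prod (Measure.pi fun _ : Fin n => μ)))
      {x | ∃ I J, K ≤ Finset.card I ∧ (∀ i, i ∈ I ↔ x.2.2 i ∈ A) ∧ split I.card x.1 = J ∧
        (subsample (subsample (fun i => g (x.2.2 i)) I) J,
          subsample (subsample (fun i => g (x.2.2 i)) I) Jᶜ, x.2.1) ∈ B J.card Jᶜ.card} ≤ r := by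
  classical
  set S : Finset (Fin n) → Set (Fin n → α) := fun I => {y | ∀ i, i ∈ I ↔ y i ∈ A} with hS
  -- The sets `B l m` need not be measurable; they are replaced by measurable hulls of the same
  -- measure.
  let M : (l m : ℕ) → Set ((Fin l → β) × (Fin m → β) × X) := fun l m =>
    toMeasurable ((Measure.pi fun _ : Fin l => Q).prod ((Measure.pi fun _ : Fin m => Q).prod ν))
      (B l m)
  let E : {N : ℕ} → Finset (Fin N) → Set (X × (Fin N → β)) := fun J =>
    (fun w => (subsample w.2 J, subsample w.2 Jᶜ, w.1)) ⁻¹' M J.card Jᶜ.card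
  have hE : ∀ {N : ℕ} (J : Finset (Fin N)), MeasurableSet (E J) := fun J =>
    (((measurable_subsample J).comp measurable_snd).prodMk
      (((measurable_subsample Jᶜ).comp measurable_snd).prodMk measurable_fst))
      (measurableSet_toMeasurable _ _)
  have hEle : ∀ {N : ℕ} (J : Finset (Fin N)), L ≤ J.card → L ≤ Jᶜ.card →
      (ν.prod (Measure.pi fun _ : Fin N => Q)) (E J) ≤ r := by
    intro N J h1 h2
    have hmp : MeasurePreserving
        (fun w : X × (Fin N → β) => (subsample w.2 J, subsample w.2 Jᶜ, w.1))
        (ν.prod (Measure.pi fun _ : Fin N => Q))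
        ((Measure.pi fun _ : Fin J.card => Q).prod
          ((Measure.pi fun _ : Fin Jᶜ.card => Q).prod ν)) :=
      ((measurePreserving_prodAssoc _ _ _).comp
        ((measurePreserving_subsample_prod_compl Q J).prod (MeasurePreserving.id ν))).comp
        Measure.measurePreserving_swap
    rw [hmp.measure_preimage (measurableSet_toMeasurable _ _).nullMeasurableSet,
      measure_toMeasurable]
    exact hB _ h1 _ h2
  let F : (I : Finset (Fin n)) → Finset (Fin I.card) → Set (X × (Fin n → α)) := fun I J =>
    {w | (∀ i, i ∈ I ↔ w.2 i ∈ A) ∧ (w.1, subsample (fun i => g (w.2 i)) I) ∈ E J}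
  have hsub : {x : 𝒰 × X × (Fin n → α) | ∃ I J, K ≤ Finset.card I ∧
        (∀ i, i ∈ I ↔ x.2.2 i ∈ A) ∧ split I.card x.1 = J ∧
        (subsample (subsample (fun i => g (x.2.2 i)) I) J,
          subsample (subsample (fun i => g (x.2.2 i)) I) Jᶜ, x.2.1) ∈ B J.card Jᶜ.card} ⊆
      ⋃ I ∈ (Finset.univ.filter fun I : Finset (Fin n) => K ≤ I.card),
        ⋃ J ∈ (Finset.univ : Finset (Finset (Fin I.card))),
          {u | split I.card u = J} ×ˢ F I J := by
    rintro ⟨u, x, y⟩ ⟨I, J, hI, hIy, hJ, hmem⟩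
    simp only [Set.mem_iUnion]
    exact ⟨I, by simpa using hI, J, Finset.mem_univ _, hJ, hIy, subset_toMeasurable _ _ hmem⟩
  have hterm : ∀ I : Finset (Fin n), K ≤ I.card → ∀ J : Finset (Fin I.card),
      (W.prod (ν.prod (Measure.pi fun _ : Fin n => μ))) ({u | split I.card u = J} ×ˢ F I J)
        ≤ W {u | split I.card u = J} * ((Measure.pi fun _ : Fin n => μ) (S I) * r) := by
    intro I hI J
    rw [Measure.prod_prod]
    -- For a J that no seed produces the sizes are not controlled, but its weight is zero.
    rcases Set.eq_empty_or_nonempty {u | split I.card u = J} with h | ⟨u, hu⟩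
    · simp [h]
    · have hcard := hK _ hI u
      rw [Set.mem_ofPred.1 hu] at hcard
      rw [prod_pi_selected hA hg hp ν I (hE J)]
      gcongr
      exact hEle J hcard.1 hcard.2
  have hW : ∀ N, ∑ J : Finset (Fin N), W {u | split N u = J} = 1 := fun N => by
    have := sum_measure_preimage_singleton (μ := W) (Finset.univ : Finset (Finset (Fin N)))
      (f := split N) fun J _ => hsplit N J
    rwa [Finset.coe_univ, Set.preimage_univ, measure_univ] at this
  have hSsum : ∑ I : Finset (Fin n), (Measure.pi fun _ : Fin n => μ) (S I) = 1 := by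
    have hpre : ∀ I : Finset (Fin n),
        (fun y : Fin n → α => Finset.univ.filter fun i => y i ∈ A) ⁻¹' {I} = S I := fun I => by
      ext y
      simp only [Set.mem_preimage, Set.mem_singleton_iff, hS, Set.mem_ofPred_eq, Finset.ext_iff,
        Finset.mem_filter, Finset.mem_univ, true_and]
      exact forall_congr' fun i => Iff.comm
    have := sum_measure_preimage_singleton (μ := Measure.pi fun _ : Fin n => μ)
      (Finset.univ : Finset (Finset (Fin n)))
      (f := fun y : Fin n → α => Finset.univ.filter fun i => y i ∈ A)
      fun I _ => by rw [hpre]; exact measurableSet_selected hA I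
    simp_rw [hpre] at this
    simpa using this
  calc _ ≤ ∑ I ∈ Finset.univ.filter fun I : Finset (Fin n) => K ≤ I.card,
        ∑ J : Finset (Fin I.card), (W.prod (ν.prod (Measure.pi fun _ : Fin n => μ)))
          ({u | split I.card u = J} ×ˢ F I J) :=
        (measure_mono hsub).trans ((measure_biUnion_finset_le _ _).trans
          (Finset.sum_le_sum fun I _ => measure_biUnion_finset_le _ _))
    _ ≤ ∑ I ∈ Finset.univ.filter fun I : Finset (Fin n) => K ≤ I.card,
        ∑ J : Finset (Fin I.card), W {u | split I.card u = J} *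
          ((Measure.pi fun _ : Fin n => μ) (S I) * r) :=
        Finset.sum_le_sum fun I hI => Finset.sum_le_sum fun J _ =>
          hterm I (Finset.mem_filter.1 hI).2 J
    _ = ∑ I ∈ Finset.univ.filter fun I : Finset (Fin n) => K ≤ I.card,
          (Measure.pi fun _ : Fin n => μ) (S I) * r := by
        refine Finset.sum_congr rfl fun I _ => ?_
        rw [← Finset.sum_mul, hW, one_mul]
    _ ≤ ∑ I : Finset (Fin n), (Measure.pi fun _ : Fin n => μ) (S I) * r :=
        Finset.sum_le_sum_of_subset (Finset.filter_subset _ _)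
    _ = r := by rw [← Finset.sum_mul, hSsum, one_mul]

end Selection

lemma IsSplitRule.exists_forall_le_card {𝒰 : Type*} [MeasurableSpace 𝒰] {γ : ℝ}
    (hγ : γ ∈ Set.Ioo (0 : ℝ) 1) {split : (N : ℕ) → 𝒰 → Finset (Fin N)}
    (hsplit : IsSplitRule γ split) (L : ℕ) :
    ∃ K : ℕ, ∀ N ≥ K, ∀ u, L ≤ (split N u).card ∧ L ≤ (split N u)ᶜ.card := by
  have hγ0 : 0 < γ := hγ.1
  have hγ1 : 0 < 1 - γ := by linarith [hγ.2]
  -- The extra 1 in the second bound pays for rounding γN up, which shrinks the training part.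
  refine ⟨max ⌈L / γ⌉₊ ⌈(L + 1) / (1 - γ)⌉₊, fun N hN u => ?_⟩
  have h1 : (L : ℝ) / γ ≤ N := Nat.ceil_le.1 (le_of_max_le_left hN)
  have h2 : ((L : ℝ) + 1) / (1 - γ) ≤ N := Nat.ceil_le.1 (le_of_max_le_right hN)
  rw [div_le_iff₀ hγ0] at h1
  rw [div_le_iff₀ hγ1] at h2
  have hcard := hsplit.card_calibration N u
  have htot : ((split N u).card : ℝ) + (split N u)ᶜ.card = N := by
    exact_mod_cast (Finset.card_add_card_compl (split N u)).trans (Fintype.card_fin N)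
  have h3 := Nat.le_ceil (γ * (N : ℝ))
  have h4 := Nat.ceil_lt_add_one (a := γ * (N : ℝ)) (by positivity)
  rw [← hcard] at h3 h4
  constructor
  · have : (L : ℝ) ≤ (split N u).card := by linarith
    exact_mod_cast this
  · have : (L : ℝ) ≤ (split N u)ᶜ.card := by linarith
    exact_mod_cast this

/-- Once K ≤ np/2, a count below K deviates from its mean np by at least np/2. -/
lemma tendsto_pi_card_lt {α : Type*} [MeasurableSpace α] {μ : Measure α} [IsProbabilityMeasure μ]
    {A : Set α} [DecidablePred (· ∈ A)] (hA : MeasurableSet A) (hpos : 0 < μ.real A) (K : ℕ) :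
    Tendsto (fun n : ℕ => (Measure.pi fun _ : Fin n => μ)
      {y | (Finset.univ.filter fun i => y i ∈ A).card < K}) atTop (𝓝 0) := by
  set p := μ.real A with hp
  have hlim : Tendsto (fun n : ℕ => ENNReal.ofReal (1 / (n * (p / 2) ^ 2))) atTop (𝓝 0) := by
    rw [← ENNReal.ofReal_zero]
    refine (ENNReal.continuous_ofReal.tendsto 0).comp ?_
    exact tendsto_const_nhds.div_atTop
      (tendsto_natCast_atTop_atTop.atTop_mul_const (by positivity))
  refine tendsto_of_tendsto_of_tendsto_of_le_of_le' tendsto_const_nhds hlim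
    (Eventually.of_forall fun _ => zero_le) ?_
  filter_upwards [eventually_ge_atTop ⌈K / (p / 2)⌉₊, eventually_ne_atTop 0] with n hn hn0
  have hn' : (K : ℝ) / (p / 2) ≤ n := Nat.ceil_le.1 hn
  rw [div_le_iff₀ (by positivity)] at hn'
  refine le_trans (measure_mono fun y hy => ?_)
    (pi_abs_card_sub_ge_le μ hA hn0 (κ := p / 2) (by positivity))
  have hy' : ((Finset.univ.filter fun i => y i ∈ A).card : ℝ) ≤ K := by
    exact_mod_cast (Set.mem_ofPred.1 hy).le
  refine Set.mem_ofPred.2 (le_trans ?_ (neg_le_abs _))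
  linarith

/-! ### The joint law of the experiment -/

lemma IsExperiment.map_eq {Ω 𝒮 𝒜 𝒰 : Type*} [MeasurableSpace Ω] [MeasurableSpace 𝒮]
    [MeasurableSpace 𝒜] [MeasurableSpace 𝒰] {P : Measure Ω} [IsProbabilityMeasure P]
    {PS : Measure 𝒮} {Pobs : Measure (𝒮 × 𝒜 × ℝ)} [IsProbabilityMeasure Pobs]
    {D : ℕ → Ω → 𝒮 × 𝒜 × ℝ} {V : ℕ → Ω → ℝ} {X : ℕ → Ω → 𝒮} {U : ℕ → Ω → 𝒰}
    (h : IsExperiment P PS Pobs D V X U) (n : ℕ) :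
    P.map (fun ω => (U n ω, X n ω, fun i : Fin n => (D i ω, V i ω)))
      = (P.map (U n)).prod (PS.prod
        (Measure.pi fun _ : Fin n => Pobs.prod (volume.restrict (Set.Icc (0 : ℝ) 1)))) := by
  have hDm : Measurable fun ω => fun i : Fin n => D i ω :=
    measurable_pi_lambda _ fun i => h.measurable_D i
  have hVm : Measurable fun ω => fun i : Fin n => V i ω :=
    measurable_pi_lambda _ fun i => h.measurable_V i
  have hD : P.map (fun ω => fun i : Fin n => D i ω) = Measure.pi fun _ : Fin n => Pobs := by
    have := (iIndepFun_iff_map_fun_eq_pi_map fun i : Fin n => (h.measurable_D i).aemeasurable).1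
      (h.indep_D.precomp Fin.val_injective)
    simpa only [h.law_D] using this
  have hV : P.map (fun ω => fun i : Fin n => V i ω)
      = Measure.pi fun _ : Fin n => volume.restrict (Set.Icc (0 : ℝ) 1) := by
    have := (iIndepFun_iff_map_fun_eq_pi_map fun i : Fin n => (h.measurable_V i).aemeasurable).1
      (h.indep_V.precomp Fin.val_injective)
    simpa only [h.law_V] using this
  have hDV : P.map (fun ω => ((fun i : Fin n => D i ω), (fun i : Fin n => V i ω)))
      = (Measure.pi fun _ : Fin n => Pobs).prod
        (Measure.pi fun _ : Fin n => volume.restrict (Set.Icc (0 : ℝ) 1)) := by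
    have hind : IndepFun (fun ω => fun i : Fin n => D i ω) (fun ω => fun i : Fin n => V i ω) P :=
      h.indep_D_V.comp
        (φ := fun (f : ℕ → 𝒮 × 𝒜 × ℝ) (i : Fin n) => f i) (ψ := fun (f : ℕ → ℝ) (i : Fin n) => f i)
        (by fun_prop) (by fun_prop)
    rw [(indepFun_iff_map_prod_eq_prod_map_map hDm.aemeasurable hVm.aemeasurable).1 hind, hD, hV]
  have hX : P.map (fun ω => (X n ω, (fun i : Fin n => D i ω), (fun i : Fin n => V i ω)))
      = PS.prod ((Measure.pi fun _ : Fin n => Pobs).prod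
        (Measure.pi fun _ : Fin n => volume.restrict (Set.Icc (0 : ℝ) 1))) := by
    rw [(indepFun_iff_map_prod_eq_prod_map_map (h.measurable_X n).aemeasurable
      (hDm.prodMk hVm).aemeasurable).1 (h.indep_X n), h.law_X, hDV]
  have hU := (indepFun_iff_map_prod_eq_prod_map_map (h.measurable_U n).aemeasurable
      ((h.measurable_X n).prodMk (hDm.prodMk hVm)).aemeasurable).1 (h.indep_U n)
  rw [hX] at hU
  have : IsProbabilityMeasure (P.map (U n)) :=
    Measure.isProbabilityMeasure_map (h.measurable_U n).aemeasurable
  have : IsProbabilityMeasure PS := by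
    rw [← h.law_X n]
    exact Measure.isProbabilityMeasure_map (h.measurable_X n).aemeasurable
  -- Turns the pair of tuples of observations and uniforms into a tuple of i.i.d. pairs, on which
  -- the selection acts coordinatewise.
  have hzip := (measurePreserving_arrowProdEquivProdArrow (𝒮 × 𝒜 × ℝ) ℝ (Fin n)
    (fun _ => Pobs) (fun _ => volume.restrict (Set.Icc (0 : ℝ) 1))).symm
  have hfull := (MeasurePreserving.id (P.map (U n))).prod ((MeasurePreserving.id PS).prod hzip)
  rw [← hfull.map_eq, ← hU, Measure.map_map hfull.measurable
    ((h.measurable_U n).prodMk ((h.measurable_X n).prodMk (hDm.prodMk hVm)))]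
  rfl

/-- The types of the split and of both subsamples depend on the random index set. Naming I and J as
variables allows substitution instead of rewriting under dependent types. -/
lemma pacopp_eq {𝒮 𝒜 𝒰 : Type*} {pb pe : 𝒮 → 𝒜 → ℝ≥0} {ε δ : ℝ}
    {split : (N : ℕ) → 𝒰 → Finset (Fin N)}
    {qloHat qupHat : (l : ℕ) → (Fin l → 𝒮 × ℝ) → 𝒮 → ℝ} {n : ℕ} {d : Fin n → 𝒮 × 𝒜 × ℝ}
    {v : Fin n → ℝ} {u : 𝒰} {s : 𝒮} {I : Finset (Fin n)} (hI : acceptedIdx pb pe d v = I)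
    {J : Finset (Fin I.card)} (hJ : split I.card u = J) :
    pacopp pb pe ε δ split qloHat qupHat d v u s
      = pacCP ε δ (qloHat J.card (subsample (subsample (fun i => ((d i).1, (d i).2.2)) I) J))
        (qupHat J.card (subsample (subsample (fun i => ((d i).1, (d i).2.2)) I) J))
        (subsample (subsample (fun i => ((d i).1, (d i).2.2)) I) Jᶜ) s := by
  subst hI hJ
  rfl

end PACOPP

theorem theorem4
    {Ω 𝒮 𝒜 𝒰 : Type*} [MeasurableSpace Ω] [MeasurableSpace 𝒮] [MeasurableSpace 𝒜]
    [MeasurableSpace 𝒰]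
    -- the contextual bandit, the behavior policy and the target policy
    (PS : Measure 𝒮) [IsProbabilityMeasure PS]
    (PR : Kernel (𝒮 × 𝒜) ℝ) [IsMarkovKernel PR]
    (ν : Kernel 𝒮 𝒜) [IsSFiniteKernel ν]
    (pb pe : 𝒮 → 𝒜 → ℝ≥0)
    (hpb : PACOPP.IsPolicyDensity ν pb) (hpe : PACOPP.IsPolicyDensity ν pe)
    (hB : (PACOPP.ratioBounds pb pe).Nonempty)
    -- the parameters of the algorithm
    (ε δ γ εlo εup : ℝ) (hε : ε ∈ Set.Ioo (0 : ℝ) 1) (hδ : δ ∈ Set.Ioo (0 : ℝ) 1)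
    (hγ : γ ∈ Set.Ioo (0 : ℝ) 1) (hεlo : 0 ≤ εlo) (hεup : εup ≤ 1) (hlevels : εup - εlo = 1 - ε)
    (split : (N : ℕ) → 𝒰 → Finset (Fin N)) (hsplit : PACOPP.IsSplitRule γ split)
    (qloHat qupHat : (l : ℕ) → (Fin l → 𝒮 × ℝ) → 𝒮 → ℝ)
    (hqloHat : ∀ l, Measurable (Function.uncurry (qloHat l)))
    (hqupHat : ∀ l, Measurable (Function.uncurry (qupHat l)))
    -- the data, the uniform variables, the test contexts and the seeds of the split
    (P : Measure Ω) [IsProbabilityMeasure P]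
    (D : ℕ → Ω → 𝒮 × 𝒜 × ℝ) (V : ℕ → Ω → ℝ) (X : ℕ → Ω → 𝒮) (U : ℕ → Ω → 𝒰)
    (hexp : PACOPP.IsExperiment P PS (PACOPP.observationLaw PS (PACOPP.policy ν pb) PR) D V X U)
    -- the oracle conditional quantiles under the target policy
    (qlo qup : 𝒮 → ℝ)
    (hqlo : PACOPP.IsConditionalQuantile PS
      (PACOPP.rewardKernel (PACOPP.policy ν pe) PR) εlo qlo)
    (hqup : PACOPP.IsConditionalQuantile PS
      (PACOPP.rewardKernel (PACOPP.policy ν pe) PR) εup qup)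
    -- consistency of the quantile estimates
    (hcons : PACOPP.QuantileConsistency PS
      (PACOPP.contextRewardLaw PS (PACOPP.policy ν pe) PR) qloHat qupHat qlo qup)
    -- regularity of the oracle score
    (hreg : PACOPP.DensityPositiveNearZero
      ((PACOPP.contextRewardLaw PS (PACOPP.policy ν pe) PR).map (PACOPP.score qlo qup))) :
    ∀ η : ℝ, 0 < η →
      Tendsto
        (fun n : ℕ => P {ω | ENNReal.ofReal η ≤
          volume (symmDiff
            (PACOPP.pacopp pb pe ε δ split qloHat qupHat
              (fun i : Fin n => D i ω) (fun i : Fin n => V i ω) (U n ω) (X n ω))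
            (Set.Icc (qlo (X n ω)) (qup (X n ω))))})
        atTop (𝓝 0) := by
  classical
  intro η hη
  have := hpe.isMarkovKernel
  have := hpb.isMarkovKernel
  have hne : Nonempty 𝒮 := nonempty_of_isProbabilityMeasure PS
  have hMarkov : IsMarkovKernel (PACOPP.rewardKernel (PACOPP.policy ν pe) PR) := by
    unfold PACOPP.rewardKernel; infer_instance
  have hobs : IsProbabilityMeasure (PACOPP.observationLaw PS (PACOPP.policy ν pb) PR) := by
    unfold PACOPP.observationLaw; infer_instance
  have hQ : IsProbabilityMeasure (PACOPP.contextRewardLaw PS (PACOPP.policy ν pe) PR) := by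
    unfold PACOPP.contextRewardLaw; infer_instance
  have hunif : IsProbabilityMeasure (volume.restrict (Set.Icc (0 : ℝ) 1)) := ⟨by simp⟩
  set μ := (PACOPP.observationLaw PS (PACOPP.policy ν pb) PR).prod
    (volume.restrict (Set.Icc (0 : ℝ) 1)) with hμ
  set Q := PACOPP.contextRewardLaw PS (PACOPP.policy ν pe) PR with hQdef
  set A := PACOPP.acceptRegion pb pe with hAdef
  have hA : MeasurableSet A := PACOPP.measurableSet_acceptRegion hpb hpe
  set g : (𝒮 × 𝒜 × ℝ) × ℝ → 𝒮 × ℝ := fun y => (y.1.1, y.1.2.2) with hgdef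
  have hg : Measurable g := by fun_prop
  have hp : ∀ E, MeasurableSet E →
      μ (A ∩ g ⁻¹' E) = (1 / PACOPP.ratioBound pb pe : ℝ≥0) * Q E :=
    fun E hE => PACOPP.measure_acceptRegion_inter PS PR hpb hpe hB hE
  have hpos : 0 < μ.real A := by
    have h1 := hp Set.univ MeasurableSet.univ
    rw [Set.preimage_univ, Set.inter_univ, measure_univ, mul_one] at h1
    have h2 := PACOPP.one_le_ratioBound hpb hpe hB
    rw [measureReal_def, h1, ENNReal.coe_toReal]
    have : 0 < 1 / PACOPP.ratioBound pb pe := one_div_pos.2 (zero_lt_one.trans_le h2)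
    exact_mod_cast this
  rw [ENNReal.tendsto_nhds_zero]
  intro e he
  -- The tolerance may be infinite, so it is capped at 1 before being halved as a real number: one
  -- half for too few kept pairs, one for the fixed-size bound.
  have hmin0 : 0 < min e 1 := lt_min he zero_lt_one
  have hmin1 : min e 1 ≠ ⊤ := ne_top_of_le_ne_top ENNReal.one_ne_top (min_le_right _ _)
  have hr : 0 < (min e 1).toReal / 2 := half_pos (ENNReal.toReal_pos hmin0.ne' hmin1)
  set r := (min e 1).toReal / 2 with hrdef
  have hrr : ENNReal.ofReal r + ENNReal.ofReal r ≤ e := by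
    rw [← ENNReal.ofReal_add hr.le hr.le, hrdef, add_halves, ENNReal.ofReal_toReal hmin1]
    exact min_le_left _ _
  obtain ⟨L, hL⟩ := PACOPP.exists_forall_prod_pacCP_le hε hδ hlevels hqlo hqup hqloHat hqupHat
    hcons hreg hη hr
  obtain ⟨K, hK⟩ := hsplit.exists_forall_le_card hγ L
  have hsmall := (ENNReal.tendsto_nhds_zero.1 (PACOPP.tendsto_pi_card_lt hA hpos K))
    (ENNReal.ofReal r) (ENNReal.ofReal_pos.2 hr)
  filter_upwards [hsmall] with n hn
  have hU : IsProbabilityMeasure (P.map (U n)) :=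
    Measure.isProbabilityMeasure_map (hexp.measurable_U n).aemeasurable
  have hbig := PACOPP.prod_selected_split_le hA hg hp PS (P.map (U n)) hsplit.measurableSet_eq hK
    (fun l m => {x | ENNReal.ofReal η ≤ volume (symmDiff
      (PACOPP.pacCP ε δ (qloHat l x.1) (qupHat l x.1) x.2.1 x.2.2)
      (Set.Icc (qlo x.2.2) (qup x.2.2)))}) hL n
  set bad : Set (𝒰 × 𝒮 × (Fin n → (𝒮 × 𝒜 × ℝ) × ℝ)) := {x | ENNReal.ofReal η ≤
    volume (symmDiff (PACOPP.pacopp pb pe ε δ split qloHat qupHat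
      (fun i => (x.2.2 i).1) (fun i => (x.2.2 i).2) x.1 x.2.1)
      (Set.Icc (qlo x.2.1) (qup x.2.1)))} with hbad
  have hmeas : Measurable fun ω => (U n ω, X n ω, fun i : Fin n => (D i ω, V i ω)) :=
    (hexp.measurable_U n).prodMk ((hexp.measurable_X n).prodMk
      (measurable_pi_lambda _ fun i => (hexp.measurable_D i).prodMk (hexp.measurable_V i)))
  have hcover : bad ⊆
      (Set.univ ×ˢ (Set.univ ×ˢ {y | (Finset.univ.filter fun i => y i ∈ A).card < K})) ∪
      {x | ∃ I J, K ≤ Finset.card I ∧ (∀ i, i ∈ I ↔ x.2.2 i ∈ A) ∧ split I.card x.1 = J ∧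
        (PACOPP.subsample (PACOPP.subsample (fun i => g (x.2.2 i)) I) J,
          PACOPP.subsample (PACOPP.subsample (fun i => g (x.2.2 i)) I) Jᶜ, x.2.1) ∈
          {x | ENNReal.ofReal η ≤ volume (symmDiff
            (PACOPP.pacCP ε δ (qloHat J.card x.1) (qupHat J.card x.1) x.2.1 x.2.2)
            (Set.Icc (qlo x.2.2) (qup x.2.2)))}} := by
    rintro ⟨u, s, y⟩ hx
    rcases lt_or_ge (Finset.univ.filter fun i => y i ∈ A).card K with hlt | hge
    · exact Or.inl ⟨Set.mem_univ _, Set.mem_univ _, hlt⟩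
    · refine Or.inr ⟨Finset.univ.filter fun i => y i ∈ A, _, hge, by simp, rfl, ?_⟩
      have hacc : PACOPP.acceptedIdx pb pe (fun i => (y i).1) (fun i => (y i).2)
          = Finset.univ.filter fun i => y i ∈ A := by
        ext i
        simp [PACOPP.acceptedIdx, hAdef, PACOPP.acceptRegion]
      rw [hbad, Set.mem_ofPred_eq, PACOPP.pacopp_eq hacc rfl] at hx
      exact hx
  calc P {ω | ENNReal.ofReal η ≤ volume (symmDiff
          (PACOPP.pacopp pb pe ε δ split qloHat qupHat
            (fun i : Fin n => D i ω) (fun i : Fin n => V i ω) (U n ω) (X n ω))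
          (Set.Icc (qlo (X n ω)) (qup (X n ω))))}
      = P ((fun ω => (U n ω, X n ω, fun i : Fin n => (D i ω, V i ω))) ⁻¹' bad) := rfl
    -- Only this inequality is needed, and it holds for any set, measurable or not.
    _ ≤ P.map (fun ω => (U n ω, X n ω, fun i : Fin n => (D i ω, V i ω))) bad :=
        Measure.le_map_apply hmeas.aemeasurable _
    _ = ((P.map (U n)).prod (PS.prod (Measure.pi fun _ : Fin n => μ))) bad := by
        rw [hexp.map_eq n]
    _ ≤ ENNReal.ofReal r + ENNReal.ofReal r := by
        refine (measure_mono hcover).trans ((measure_union_le _ _).trans (add_le_add ?_ hbig))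
        rw [Measure.prod_prod, Measure.prod_prod, measure_univ, measure_univ, one_mul, one_mul]
        exact hn
    _ ≤ e := hrr
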